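/- Let $\mathbb{Q}_{\mathbb R}=\{\beta_1+\beta_2 j:\beta_1,\beta_2\in\mathbb C\}$ be the commutative algebra of reduced biquaternions, $j^2=1$. For a matrix $M=M_1+M_2j$ over $\mathbb{Q}_{\mathbb R}$ ($M_1,M_2$ complex) put $M_c=\begin{bmatrix}M_1\\M_2\end{bmatrix}$ and $\|M\|_F=(\|M_1\|_F^2+\|M_2\|_F^2)^{1/2}$. Let $A\in\mathbb{Q}_{\mathbb R}^{m\times n}$, $B\in\mathbb{Q}_{\mathbb R}^{m\times d}$, $C\in\mathbb{Q}_{\mathbb R}^{p\times n}$, $D\in\mathbb{Q}_{\mathbb R}^{p\times d}$ with $m\ge n+d$ and $C_c$ of full row rank $2p$. A matrix $X\in\mathbb C^{n\times d}$ is a complex RBTLSE solution for $(A,B,C,D)$ if it attains $$\min_{X,\bar G,\bar H}\|[\bar G,\bar H]\|_F\quad\text{subject to}\quad (A+\bar G)X=B+\bar H,\quad CX=D,$$ where $X$ ranges over complex and $\bar G,\bar H$ over reduced biquaternion matrices. Put $J=\begin{bmatrix}C\\A\end{bmatrix}$, $K=\begin{bmatrix}D\\B\end{bmatrix}$, $J_c=\begin{bmatrix}C_c\\A_c\end{bmatrix}$,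 $K_c=\begin{bmatrix}D_c\\B_c\end{bmatrix}$, $P=[A_c,B_c]$, $S=[C_c,D_c]$. Let $S^H=[Q_1,Q_2]\begin{bmatrix}R\\0\end{bmatrix}$ be a QR factorization ($[Q_1,Q_2]$ unitary of order $n+d$, $Q_1$ with $2p$ columns, $R$ upper triangular). Let $PQ_2=U\Sigma V^H$ be a thin SVD with singular values $\sigma_1\ge\dots\ge\sigma_{n-2p}>\sigma_{n-2p+1}\ge\dots\ge\sigma_{n-2p+d}>0$; write $U=[U_1,U_2]$, $\Sigma=\mathrm{diag}(\Sigma_1,\Sigma_2)$ and $$Q_2V=[\acute V_1,\acute V_2]=\begin{bmatrix}\acute V_{11}&\acute V_{12}\\ \acute V_{21}&\acute V_{22}\end{bmatrix},$$ with column blocks of sizes $n-2p$, $d$ and row blocks of sizes $n$, $d$. Assume that $\acute V_{22}$ is invertible. Let $S=U_sS_sV_s^H$ be a skinny SVD of $S$ and $S^\dagger$ its Moore-Penrose inverse, and put $$Q_c=\begin{bmatrix}-(PS^\dagger)^H\\ I_{2m}\end{bmatrix},\quad S_c=\begin{bmatrix}S_s&0\\0&\Sigma_1\end{bmatrix},\quad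 W_c=[V_s,\acute V_1]=\begin{bmatrix}W_{1c}\\W_{2c}\end{bmatrix},$$ with $W_{1c}$ of order $n$, and $\Pi_{(d,n)}=\sum_{i=1}^d\sum_{j=1}^nE_{ij}\otimes E_{ij}^T$, where $E_{ij}$ are the elementary matrices of size $d\times n$. Let $$H_c=(\acute V_{22}^{-T}\otimes W_{1c}^{-H})\,\Pi_{(d,n)},$$ $$G_c=\left(S_c^2\otimes I_d-\begin{bmatrix}0_{2p}&0\\0&I_{n-2p}\end{bmatrix}\otimes(\Sigma_2^H\Sigma_2)\right)^{-1}\left[I_n\otimes\Sigma_2^H,\ S_c\otimes I_d\right],$$ $$Z_c=\mathrm{diag}\left(\begin{bmatrix}0_{2p}&0\\0&I_{n-2p}\end{bmatrix}\otimes(U_2^TQ_c^T),\ \begin{bmatrix}I_{2p}&0\\-U_1^H(PS^\dagger)U_s&I_{n-2p}\end{bmatrix}\otimes I_d\right),$$ where $T$ is the plain transpose and $H$ the conjugate transpose. Let $X_{CT}$ be the complex RBTLSE solution for $(A,B,C,D)$, and suppose $X_{CT}\neq0$. Then for all sufficiently small perturbations $\Delta A,\Delta B,\Delta C,\Delta D$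 (with $\Delta J,\Delta K$ formed from them as $J,K$ are from $A,B,C,D$) the perturbed problem with data $A+\Delta A,\dots,D+\Delta D$ has exactly one complex RBTLSE solution $\widehat X_{CT}$, and with $\Delta X_{CT}=\widehat X_{CT}-X_{CT}$ the relative normwise condition number is $$\lim_{\epsilon\to0^+}\ \sup\left\{\frac{\|\Delta X_{CT}\|_F}{\epsilon\|X_{CT}\|_F}\ :\ \|[\Delta J,\Delta K]\|_F\le\epsilon\|[J,K]\|_F\right\}=\|H_cG_cZ_c\|_2\,\frac{\|[J_c,K_c]\|_F}{\|X_{CT}\|_F}.$$ -/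

import Mathlib

open Matrix Filter Topology
open scoped Kronecker ENNReal

noncomputable section

namespace RBTLSE

/-! ### Reduced biquaternions and their matrices -/

/-- The commutative algebra of reduced biquaternions: `z = z.re + z.im * j` with complex
coefficients `z.re`, `z.im` and `j ^ 2 = 1`.  With `i` the imaginary unit of `ℂ` and `k = i * j`
this gives `i ^ 2 = k ^ 2 = -1`, `i * j = j * i = k`, `j * k = k * j = i`,
`k * i = i * k = -j`. -/
abbrev RB : Type := QuadraticAlgebra ℂ 1 0

/-- The multiplication rule of the reduced biquaternions in the form `β₁ + β₂ j`. -/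
theorem rb_mul (z w : RB) :
    z * w = ⟨z.re * w.re + z.im * w.im, z.re * w.im + z.im * w.re⟩ := by
  ext <;> simp

/-- Frobenius norm of a reduced biquaternion matrix; the squared norm of an entry `β₁ + β₂ j`
is `|β₁|² + |β₂|²`. -/
def rbFrob {α β : Type*} [Fintype α] [Fintype β] (M : Matrix α β RB) : ℝ :=
  √(∑ i, ∑ j, (‖(M i j).re‖ ^ 2 + ‖(M i j).im‖ ^ 2))

/-- A complex matrix, viewed as a reduced biquaternion matrix. -/
def ofComplex {α β : Type*} (X : Matrix α β ℂ) : Matrix α β RB :=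
  X.map (algebraMap ℂ RB)

/-- First block column `[R₁; R₂]` of the complex representation `[R₁ R₂; R₂ R₁]` of
`R₁ + R₂ j`. -/
def cCol {α β : Type*} (M : Matrix α β RB) : Matrix (α ⊕ α) β ℂ :=
  fromRows (M.map QuadraticAlgebra.re) (M.map QuadraticAlgebra.im)

/-! ### Matrix norms -/

open scoped Matrix.Norms.Frobenius in
/-- Frobenius norm of a complex matrix. -/
def frobNorm {α β : Type*} [Fintype α] [Fintype β] (M : Matrix α β ℂ) : ℝ := ‖M‖

open scoped Matrix.Norms.L2Operator in
/-- Spectral norm (Euclidean operator norm) of a complex matrix. -/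
def specNorm {α β : Type*} [Fintype α] [Fintype β] [DecidableEq β] (M : Matrix α β ℂ) : ℝ := ‖M‖

/-! ### The equality-constrained total least squares problem -/

section Problem

variable {m n d p : ℕ}

/-- Feasibility: `(A + G) X = B + H` and `C X = D`, with `X` complex. -/
def IsFeasible (A : Matrix (Fin m) (Fin n) RB) (B : Matrix (Fin m) (Fin d) RB)
    (C : Matrix (Fin p) (Fin n) RB) (D : Matrix (Fin p) (Fin d) RB)
    (X : Matrix (Fin n) (Fin d) ℂ)
    (G : Matrix (Fin m) (Fin n) RB) (H : Matrix (Fin m) (Fin d) RB) : Prop :=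
  (A + G) * ofComplex X = B + H ∧ C * ofComplex X = D

/-- `X` is a complex RBTLSE solution: it is feasible with some `G`, `H` for which
`‖[G, H]‖_F` is minimal among all feasible triples. -/
def IsComplexSolution (A : Matrix (Fin m) (Fin n) RB) (B : Matrix (Fin m) (Fin d) RB)
    (C : Matrix (Fin p) (Fin n) RB) (D : Matrix (Fin p) (Fin d) RB)
    (X : Matrix (Fin n) (Fin d) ℂ) : Prop :=
  ∃ (G : Matrix (Fin m) (Fin n) RB) (H : Matrix (Fin m) (Fin d) RB),
    IsFeasible A B C D X G H ∧
    ∀ (X' : Matrix (Fin n) (Fin d) ℂ) (G' : Matrix (Fin m) (Fin n) RB)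
      (H' : Matrix (Fin m) (Fin d) RB), IsFeasible A B C D X' G' H' →
        rbFrob (fromCols G H) ≤ rbFrob (fromCols G' H')

/-- The block matrix `[J, K]` with `J = [C; A]` and `K = [D; B]`. -/
def dataJK (A : Matrix (Fin m) (Fin n) RB) (B : Matrix (Fin m) (Fin d) RB)
    (C : Matrix (Fin p) (Fin n) RB) (D : Matrix (Fin p) (Fin d) RB) :
    Matrix (Fin p ⊕ Fin m) (Fin n ⊕ Fin d) RB :=
  fromCols (fromRows C A) (fromRows D B)

/-- The block matrix `[J_c, K_c]` with `J_c = [C_c; A_c]` and `K_c = [D_c; B_c]`, where the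
subscript denotes the first block column of the complex representation. -/
def dataJKc (A : Matrix (Fin m) (Fin n) RB) (B : Matrix (Fin m) (Fin d) RB)
    (C : Matrix (Fin p) (Fin n) RB) (D : Matrix (Fin p) (Fin d) RB) :
    Matrix ((Fin p ⊕ Fin p) ⊕ (Fin m ⊕ Fin m)) (Fin n ⊕ Fin d) ℂ :=
  fromCols (fromRows (cCol C) (cCol A)) (fromRows (cCol D) (cCol B))

/-- Supremum of `‖X̂ - X‖_F / (ε ‖X‖_F)` over all perturbations with
`‖[ΔJ, ΔK]‖_F ≤ ε ‖[J, K]‖_F`, where `X̂` is the complex solution of the perturbed problem.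
The supremum is taken in `[0, ∞]`, so that no boundedness is presupposed. -/
def relChangeSup (A : Matrix (Fin m) (Fin n) RB) (B : Matrix (Fin m) (Fin d) RB)
    (C : Matrix (Fin p) (Fin n) RB) (D : Matrix (Fin p) (Fin d) RB)
    (X : Matrix (Fin n) (Fin d) ℂ) (ε : ℝ) : ℝ≥0∞ :=
  sSup {r | ∃ (ΔA : Matrix (Fin m) (Fin n) RB) (ΔB : Matrix (Fin m) (Fin d) RB)
      (ΔC : Matrix (Fin p) (Fin n) RB) (ΔD : Matrix (Fin p) (Fin d) RB)
      (X' : Matrix (Fin n) (Fin d) ℂ),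
      rbFrob (dataJK ΔA ΔB ΔC ΔD) ≤ ε * rbFrob (dataJK A B C D) ∧
      IsComplexSolution (A + ΔA) (B + ΔB) (C + ΔC) (D + ΔD) X' ∧
      r = ENNReal.ofReal (frobNorm (X' - X) / (ε * frobNorm X))}

/-- All problems obtained by sufficiently small perturbations of the data have exactly one
complex solution. -/
def IsLocallyUniquelySolvable (A : Matrix (Fin m) (Fin n) RB) (B : Matrix (Fin m) (Fin d) RB)
    (C : Matrix (Fin p) (Fin n) RB) (D : Matrix (Fin p) (Fin d) RB) : Prop :=
  ∃ δ : ℝ, 0 < δ ∧ ∀ (ΔA : Matrix (Fin m) (Fin n) RB) (ΔB : Matrix (Fin m) (Fin d) RB)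
    (ΔC : Matrix (Fin p) (Fin n) RB) (ΔD : Matrix (Fin p) (Fin d) RB),
    rbFrob (dataJK ΔA ΔB ΔC ΔD) ≤ δ →
      ∃! X' : Matrix (Fin n) (Fin d) ℂ,
        IsComplexSolution (A + ΔA) (B + ΔB) (C + ΔC) (D + ΔD) X'

/-- The relative normwise condition number of the complex solution `X` (well defined because
small perturbations of the data are uniquely solvable) equals `κ`. -/
def HasRelConditionNumber (A : Matrix (Fin m) (Fin n) RB) (B : Matrix (Fin m) (Fin d) RB)
    (C : Matrix (Fin p) (Fin n) RB) (D : Matrix (Fin p) (Fin d) RB)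
    (X : Matrix (Fin n) (Fin d) ℂ) (κ : ℝ) : Prop :=
  IsLocallyUniquelySolvable A B C D ∧
    Tendsto (relChangeSup A B C D X) (𝓝[>] 0) (𝓝 (ENNReal.ofReal κ))

end Problem

/-! ### Factorizations -/

/-- The real diagonal matrix `diag(s)` with complex entries. -/
def rdiag {α : Type*} [DecidableEq α] (s : α → ℝ) : Matrix α α ℂ :=
  diagonal fun i => (s i : ℂ)

/-- Full QR factorization `Sᴴ = [Q₁, Q₂] [R; 0]` with `[Q₁, Q₂]` unitary and `R` upper
triangular. -/
structure IsFullQR {p : ℕ} {α β : Type*} [Fintype α] [DecidableEq α] [Fintype β] [DecidableEq β]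
    (S : Matrix (Fin p ⊕ Fin p) α ℂ) (Q₁ : Matrix α (Fin p ⊕ Fin p) ℂ) (Q₂ : Matrix α β ℂ)
    (R : Matrix (Fin p ⊕ Fin p) (Fin p ⊕ Fin p) ℂ) : Prop where
  left_unitary : (fromCols Q₁ Q₂)ᴴ * fromCols Q₁ Q₂ = 1
  right_unitary : fromCols Q₁ Q₂ * (fromCols Q₁ Q₂)ᴴ = 1
  upper : R.BlockTriangular (finSumFinEquiv : Fin p ⊕ Fin p ≃ Fin (p + p))
  factor : Sᴴ = fromCols Q₁ Q₂ * fromRows R (0 : Matrix β (Fin p ⊕ Fin p) ℂ)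

/-- Singular value decomposition `M = U diag(s) Vᴴ` in which `U` and `V` have orthonormal columns
and all the (listed) singular values `s` are positive. -/
structure IsThinSVD {α β γ : Type*} [Fintype α] [Fintype β] [Fintype γ] [DecidableEq γ]
    (M : Matrix α β ℂ) (U : Matrix α γ ℂ) (s : γ → ℝ) (V : Matrix β γ ℂ) : Prop where
  left_orthonormal : Uᴴ * U = 1
  right_orthonormal : Vᴴ * V = 1
  pos : ∀ i, 0 < s i
  factor : M = U * rdiag s * Vᴴ

/-- `T` is the Moore-Penrose inverse of `S`. -/
structure IsMoorePenrose {α β : Type*} [Fintype α] [Fintype β]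
    (S : Matrix α β ℂ) (T : Matrix β α ℂ) : Prop where
  mul_mul_self : S * T * S = S
  self_mul_mul : T * S * T = T
  left_hermitian : (S * T)ᴴ = S * T
  right_hermitian : (T * S)ᴴ = T * S

/-! ### The matrices in the formula for the condition number -/

/-- Index set of size `2 p + q`, split into blocks of sizes `p`, `p`, `q`. -/
abbrev Idx (p q : ℕ) : Type := (Fin p ⊕ Fin p) ⊕ Fin q

/-- Concatenation of the blocks, for `n = 2 p + q`. -/
def idxEquiv {n p q : ℕ} (h : n = 2 * p + q) : Idx p q ≃ Fin n :=
  ((finSumFinEquiv.sumCongr (Equiv.refl (Fin q))).trans finSumFinEquiv).trans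
    (finCongr (by omega))

/-- Inverse of a square matrix whose rows and columns are indexed by different types, identified
by `e` (the result does not depend on `e`). -/
def sqInv {α β : Type*} [Fintype α] [DecidableEq α] (e : β ≃ α) (M : Matrix α β ℂ) :
    Matrix β α ℂ :=
  (M.submatrix id e.symm)⁻¹.submatrix e id

/-- The permutation matrix `Π = ∑ i j, E i j ⊗ (E i j)ᵀ` with `E i j` the elementary matrices of
size `α × β`. -/
def permPi (α β : Type*) [Fintype α] [DecidableEq α] [Fintype β] [DecidableEq β] :
    Matrix (α × β) (β × α) ℂ :=
  ∑ i : α, ∑ j : β, (single i j (1 : ℂ)) ⊗ₖ (single i j (1 : ℂ))ᵀ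

section Formula

variable {m n d p q : ℕ}

/-- `Q_c = [-(P S†)ᴴ; I]`, as a function of `T = P S†`. -/
def Qc (T : Matrix (Fin m ⊕ Fin m) (Fin p ⊕ Fin p) ℂ) :
    Matrix ((Fin p ⊕ Fin p) ⊕ (Fin m ⊕ Fin m)) (Fin m ⊕ Fin m) ℂ :=
  fromRows (-Tᴴ) 1

/-- `S_c = diag(S_s, Σ₁)`. -/
def Sc (s : Fin p ⊕ Fin p → ℝ) (σ₁ : Fin q → ℝ) : Matrix (Idx p q) (Idx p q) ℂ :=
  fromBlocks (rdiag s) 0 0 (rdiag σ₁)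

/-- `W₁`, the first `n` rows of `[V_s, V₁]`. -/
def W1c (Vs : Matrix (Fin n ⊕ Fin d) (Fin p ⊕ Fin p) ℂ) (V₁ : Matrix (Fin n ⊕ Fin d) (Fin q) ℂ) :
    Matrix (Fin n) (Idx p q) ℂ :=
  (fromCols Vs V₁).toRows₁

/-- `diag(0_{2p}, I_q)`. -/
def tailProj (p q : ℕ) : Matrix (Idx p q) (Idx p q) ℂ := fromBlocks 0 0 0 1

/-- `H_c = (V₂₂⁻ᵀ ⊗ W₁⁻ᴴ) Π`. -/
def Hc (h : n = 2 * p + q) (V22 : Matrix (Fin d) (Fin d) ℂ) (W₁ : Matrix (Fin n) (Idx p q) ℂ) :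
    Matrix (Fin d × Fin n) (Idx p q × Fin d) ℂ :=
  ((V22⁻¹)ᵀ ⊗ₖ (sqInv (idxEquiv h) W₁)ᴴ) * permPi (Fin d) (Idx p q)

/-- `G_c = (S_c² ⊗ I_d - diag(0, I) ⊗ Σ₂ᴴ Σ₂)⁻¹ [I_n ⊗ Σ₂ᴴ, S_c ⊗ I_d]`. -/
def Gc (S : Matrix (Idx p q) (Idx p q) ℂ) (Sg₂ : Matrix (Fin d) (Fin d) ℂ) :
    Matrix (Idx p q × Fin d) ((Idx p q × Fin d) ⊕ (Idx p q × Fin d)) ℂ :=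
  ((S ^ 2) ⊗ₖ (1 : Matrix (Fin d) (Fin d) ℂ) - tailProj p q ⊗ₖ (Sg₂ᴴ * Sg₂))⁻¹ *
    fromCols ((1 : Matrix (Idx p q) (Idx p q) ℂ) ⊗ₖ Sg₂ᴴ) (S ⊗ₖ (1 : Matrix (Fin d) (Fin d) ℂ))

/-- `Z_c = diag(diag(0, I) ⊗ U₂ᵀ Q_cᵀ, [I, 0; -U₁ᴴ (P S†) U_s, I] ⊗ I_d)`, with `T = P S†`. -/
def Zc (T : Matrix (Fin m ⊕ Fin m) (Fin p ⊕ Fin p) ℂ)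
    (Us : Matrix (Fin p ⊕ Fin p) (Fin p ⊕ Fin p) ℂ)
    (U₁ : Matrix (Fin m ⊕ Fin m) (Fin q) ℂ) (U₂ : Matrix (Fin m ⊕ Fin m) (Fin d) ℂ) :
    Matrix ((Idx p q × Fin d) ⊕ (Idx p q × Fin d))
      ((Idx p q × ((Fin p ⊕ Fin p) ⊕ (Fin m ⊕ Fin m))) ⊕ (Idx p q × Fin d)) ℂ :=
  fromBlocks
    (tailProj p q ⊗ₖ (U₂ᵀ * (Qc T)ᵀ)) 0
    0 ((fromBlocks 1 0 (-(U₁ᴴ * T * Us)) 1 : Matrix (Idx p q) (Idx p q) ℂ) ⊗ₖ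
        (1 : Matrix (Fin d) (Fin d) ℂ))

end Formula

end RBTLSE

end

open RBTLSE

noncomputable section

namespace RBTLSE

/-! ### The Frobenius norm -/

section Frobenius

open scoped Matrix.Norms.Frobenius

variable {α β γ κ δ : Type*} [Fintype α] [Fintype β] [Fintype γ] [Fintype κ] [Fintype δ]

/-! A complex factor `X` acts separately on the two components of a reduced biquaternion matrix.
Passing to first block columns therefore turns the problem, isometrically, into a complex one:
minimize `‖E‖` subject to `S Y = 0` and `(P + E) Y = 0`, where `Y = [X; -1]`
(`isComplexSolution_iff`).

A point with `S Y = 0` and `Pᴴ P Y = Sᴴ Λ + Y M` is the unique minimizer as soon as `P` stretches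
the span of `Y` strictly less than its orthogonal complement in `ker S`
(`existsUnique_isTLSSolution`). For the given data this span is that of `V₂`, the complement is that
of `V₁`, and the gap is `σ₂ < σ₁`. Under perturbation the gap survives by compactness of the unit
sphere, and the stationary point survives by the implicit function theorem. Hence the solution is
locally unique and a differentiable function `φ` of the data (`exists_solution_map`).

In the coordinates `Wᴴ [dX; 0] V₂₂` with `W = [Vs, V₁]`, the linearized equations decouple into
scalar ones with coefficients `s` and `σ₁² - σ₂²`. Solving them gives `H_c G_c Z_c` applied to a
vector formed from `(Δ W)ᴴ` and `Δ V₂` (`gc_zc_mulVec`). Because of the conjugate transpose, that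
vector depends only real-linearly on `Δ`. It is nevertheless no longer than `Δ`, and each complex
vector is attained by some `Δ` of equal norm, so the spectral norm of the matrix is the real
operator norm of `φ'` (`specNorm_isLeast`). The limit of the relative changes of a differentiable
map is then the usual quotient (`tendsto_sSup_relChange`). -/

theorem frob_sq_eq_sum (A : Matrix α β ℂ) : ‖A‖ ^ 2 = ∑ i, ∑ j, ‖A i j‖ ^ 2 := by
  rw [Matrix.frobenius_norm_def, ← Real.sqrt_eq_rpow, Real.sq_sqrt (by positivity)]
  simp

theorem frob_sq_eq_trace (A : Matrix α β ℂ) : ‖A‖ ^ 2 = (trace (Aᴴ * A)).re := by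
  rw [frob_sq_eq_sum, Finset.sum_comm]
  simp only [trace, diag_apply, mul_apply, conjTranspose_apply, Complex.re_sum]
  refine Finset.sum_congr rfl fun i _ => Finset.sum_congr rfl fun j _ => ?_
  rw [Complex.star_def, ← Complex.normSq_eq_conj_mul_self, Complex.ofReal_re,
    Complex.normSq_eq_norm_sq]

theorem frob_sq_add {A B : Matrix α β ℂ} (h : Aᴴ * B = 0) :
    ‖A + B‖ ^ 2 = ‖A‖ ^ 2 + ‖B‖ ^ 2 := by
  have h' : Bᴴ * A = 0 := by simpa using congrArg conjTranspose h
  simp only [frob_sq_eq_trace, conjTranspose_add, Matrix.add_mul, Matrix.mul_add, h, h',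
    trace_add, Complex.add_re, trace_zero, Complex.zero_re]
  ring

theorem frob_sq_add' {A B : Matrix α β ℂ} (h : A * Bᴴ = 0) :
    ‖A + B‖ ^ 2 = ‖A‖ ^ 2 + ‖B‖ ^ 2 := by
  rw [← frobenius_norm_conjTranspose (A + B), ← frobenius_norm_conjTranspose A,
    ← frobenius_norm_conjTranspose B, conjTranspose_add]
  exact frob_sq_add (by simpa using h)

theorem frob_mul_of_orthonormal [DecidableEq β] {Q : Matrix α β ℂ} (hQ : Qᴴ * Q = 1)
    (A : Matrix β γ ℂ) : ‖Q * A‖ = ‖A‖ := by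
  rw [← sq_eq_sq₀ (norm_nonneg _) (norm_nonneg _), frob_sq_eq_trace, frob_sq_eq_trace,
    conjTranspose_mul, Matrix.mul_assoc, ← Matrix.mul_assoc Qᴴ, hQ, Matrix.one_mul]

theorem frob_mul_conjTranspose_of_orthonormal [DecidableEq β] {Q : Matrix α β ℂ}
    (hQ : Qᴴ * Q = 1) (A : Matrix γ β ℂ) : ‖A * Qᴴ‖ = ‖A‖ := by
  rw [← frobenius_norm_conjTranspose, conjTranspose_mul, conjTranspose_conjTranspose,
    frob_mul_of_orthonormal hQ, frobenius_norm_conjTranspose]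

/-- `Q Qᴴ` is an orthogonal projection, so `A Q Qᴴ` and `A - A Q Qᴴ` obey Pythagoras. -/
theorem frob_mul_le_of_orthonormal [DecidableEq β] {Q : Matrix α β ℂ} (hQ : Qᴴ * Q = 1)
    (A : Matrix γ α ℂ) : ‖A * Q‖ ≤ ‖A‖ := by
  have h : (A * Q * Qᴴ) * (A - A * Q * Qᴴ)ᴴ = 0 := by
    simp only [conjTranspose_sub, conjTranspose_mul, conjTranspose_conjTranspose, Matrix.mul_sub,
      Matrix.mul_assoc]
    rw [← Matrix.mul_assoc Qᴴ Q, hQ, Matrix.one_mul, sub_self]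
  have := frob_sq_add' h
  rw [add_sub_cancel, frob_mul_conjTranspose_of_orthonormal hQ] at this
  exact abs_le_of_sq_le_sq' (by nlinarith [sq_nonneg ‖A - A * Q * Qᴴ‖]) (norm_nonneg _) |>.2

theorem frob_conjTranspose_mul_le_of_orthonormal [DecidableEq β] {Q : Matrix α β ℂ}
    (hQ : Qᴴ * Q = 1) (A : Matrix α γ ℂ) : ‖Qᴴ * A‖ ≤ ‖A‖ := by
  rw [← frobenius_norm_conjTranspose, ← frobenius_norm_conjTranspose A, conjTranspose_mul,
    conjTranspose_conjTranspose]
  exact frob_mul_le_of_orthonormal hQ _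

open scoped ComplexOrder MatrixOrder in
/-- The columns of a matrix with a left inverse can be orthonormalized. -/
theorem exists_orthonormalization [DecidableEq δ] {Y : Matrix κ δ ℂ} {L : Matrix δ κ ℂ}
    (hL : L * Y = 1) : ∃ T : Matrix δ δ ℂ, IsUnit T.det ∧ (Y * T)ᴴ * (Y * T) = 1 := by
  have hpsd : (Yᴴ * Y).PosSemidef := posSemidef_conjTranspose_mul_self Y
  obtain ⟨B, hB⟩ := CStarAlgebra.nonneg_iff_eq_star_mul_self.mp hpsd.nonneg
  have hinj : Function.Injective Y.mulVec := fun x y h => by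
    simpa [mulVec_mulVec, hL] using congrArg L.mulVec h
  have hu : IsUnit (Yᴴ * Y) := (PosDef.conjTranspose_mul_self Y hinj).isUnit
  have hBu : IsUnit B.det := by
    rw [hB, isUnit_iff_isUnit_det, det_mul] at hu
    exact isUnit_of_mul_isUnit_right hu
  -- Since `Yᴴ Y = Bᴴ B`, the Gram matrix of `Y B⁻¹` is `B⁻ᴴ Bᴴ B B⁻¹ = 1`.
  refine ⟨B⁻¹, isUnit_nonsing_inv_det _ hBu, ?_⟩
  rw [conjTranspose_mul, Matrix.mul_assoc, ← Matrix.mul_assoc Yᴴ, hB, star_eq_conjTranspose,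
    Matrix.mul_assoc Bᴴ, mul_nonsing_inv _ hBu, Matrix.mul_one, ← conjTranspose_mul,
    mul_nonsing_inv _ hBu, conjTranspose_one]

end Frobenius

/-! ### Minimality of stationary points -/

section Minimality

open scoped Matrix.Norms.Frobenius

variable {α β ν δ : Type*} [Fintype α] [Fintype β] [Fintype ν] [Fintype δ] [DecidableEq δ]

/-- The matrix `[X; -1]`. -/
def augment (X : Matrix ν δ ℂ) : Matrix (ν ⊕ δ) δ ℂ := fromRows X (-1)

omit [Fintype ν] [Fintype δ] in
theorem augment_injective : Function.Injective (augment : Matrix ν δ ℂ → Matrix (ν ⊕ δ) δ ℂ) := fun _ _ h =>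
  (fromRows_inj.eq_iff.mp h).1

theorem leftInv_mul_augment (X : Matrix ν δ ℂ) :
    fromCols (0 : Matrix δ ν ℂ) (-1 : Matrix δ δ ℂ) * augment X = 1 := by
  simp [augment, fromCols_mul_fromRows]

/-- `X` solves the total least squares problem with constraint `S [X; -1] = 0` and
`(P + E) [X; -1] = 0`. -/
def IsTLSSolution (S : Matrix α (ν ⊕ δ) ℂ) (P : Matrix β (ν ⊕ δ) ℂ) (X : Matrix ν δ ℂ) : Prop :=
  ∃ E : Matrix β (ν ⊕ δ) ℂ, (S * augment X = 0 ∧ (P + E) * augment X = 0) ∧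
    ∀ (X' : Matrix ν δ ℂ) (E' : Matrix β (ν ⊕ δ) ℂ),
      S * augment X' = 0 → (P + E') * augment X' = 0 → ‖E‖ ≤ ‖E'‖

/-- Let `Y` and `F` be orthonormal bases of the spans of `[X; -1]` and of a competitor `[X'; -1]`,
and split `F = Y b + R` with `R` orthogonal to `Y`. Feasibility gives `E' F = -P F`, so `‖E'‖ ≥ ‖P
F‖`. Replacing `Y` by `F` trades a part of `Y` for `R`, of the same norm: the loss is at most `c
‖R‖²` and the gain at least `c' ‖R‖²`. Equality forces `R = 0`, that is, equal spans. -/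
theorem existsUnique_isTLSSolution {S : Matrix α (ν ⊕ δ) ℂ} {P : Matrix β (ν ⊕ δ) ℂ}
    {X : Matrix ν δ ℂ} {Λ : Matrix α δ ℂ} {M : Matrix δ δ ℂ} {c c' : ℝ} (hc : c < c')
    (hS : S * augment X = 0) (hP : Pᴴ * (P * augment X) = Sᴴ * Λ + augment X * M)
    (hle : ∀ x : Matrix δ (ν ⊕ δ) ℂ,
      ‖P * (augment X * x)‖ ^ 2 ≤ c * ‖augment X * x‖ ^ 2)
    (hge : ∀ r : Matrix (ν ⊕ δ) δ ℂ, S * r = 0 → (augment X)ᴴ * r = 0 →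
      c' * ‖r‖ ^ 2 ≤ ‖P * r‖ ^ 2) :
    IsTLSSolution S P X ∧ ∀ X', IsTLSSolution S P X' → X' = X := by
  obtain ⟨T, hT, hYo⟩ := exists_orthonormalization (leftInv_mul_augment X)
  set Y := augment X * T with hY
  have hSY : S * Y = 0 := by rw [hY, ← Matrix.mul_assoc, hS, Matrix.zero_mul]
  have hPY : Pᴴ * (P * Y) = Sᴴ * (Λ * T) + Y * (T⁻¹ * M * T) := by
    have : Y * (T⁻¹ * M * T) = augment X * M * T := by
      rw [hY, Matrix.mul_assoc T⁻¹, Matrix.mul_assoc (augment X), ← Matrix.mul_assoc T T⁻¹,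
        mul_nonsing_inv _ hT, Matrix.one_mul, Matrix.mul_assoc]
    rw [this, hY, ← Matrix.mul_assoc P, ← Matrix.mul_assoc Pᴴ, hP, Matrix.add_mul,
      Matrix.mul_assoc Sᴴ]
  have hXY : augment X = Y * T⁻¹ := by
    rw [hY, Matrix.mul_assoc, mul_nonsing_inv _ hT, Matrix.mul_one]
  clear_value Y
  have key : ∀ (X' : Matrix ν δ ℂ) (E' : Matrix β (ν ⊕ δ) ℂ),
      S * augment X' = 0 → (P + E') * augment X' = 0 →
      ∃ (b T' : Matrix δ δ ℂ) (R : Matrix (ν ⊕ δ) δ ℂ), IsUnit T'.det ∧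
        augment X' * T' = Y * b + R ∧ ‖P * Y‖ ^ 2 + (c' - c) * ‖R‖ ^ 2 ≤ ‖E'‖ ^ 2 := by
    intro X' E' hS' hE'
    obtain ⟨T', hT', hFo⟩ := exists_orthonormalization (leftInv_mul_augment X')
    set F := augment X' * T' with hF
    have hSF : S * F = 0 := by rw [hF, ← Matrix.mul_assoc, hS', Matrix.zero_mul]
    have hEF : E' * F = -(P * F) := by
      rw [eq_neg_iff_add_eq_zero, add_comm, ← Matrix.add_mul, hF, ← Matrix.mul_assoc, hE',
        Matrix.zero_mul]
    clear_value F
    set b := Yᴴ * F with hb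
    set R := F - Y * b with hR
    -- `D` is the part of `Yᴴ` that annihilates `F`. As `Y` and `F` have the same Frobenius norm,
    -- `‖D‖ = ‖R‖`.
    set D := Yᴴ - b * Fᴴ with hD
    have hFR : F = Y * b + R := by rw [hR]; abel
    have hYR : Yᴴ * R = 0 := by
      rw [hR, Matrix.mul_sub, ← Matrix.mul_assoc, hYo, Matrix.one_mul, hb, sub_self]
    have hSR : S * R = 0 := by
      rw [hR, Matrix.mul_sub, hSF, ← Matrix.mul_assoc, hSY, Matrix.zero_mul, sub_zero]
    have hXR : (augment X)ᴴ * R = 0 := by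
      rw [hXY, conjTranspose_mul, Matrix.mul_assoc, hYR, Matrix.mul_zero]
    have hDF : D * F = 0 := by
      rw [hD, Matrix.sub_mul, Matrix.mul_assoc, hFo, Matrix.mul_one, hb, sub_self]
    have hYD : Yᴴ = D + b * Fᴴ := by rw [hD]; abel
    have e1 : ‖P * F‖ ^ 2 = ‖P * Y * b‖ ^ 2 + ‖P * R‖ ^ 2 := by
      rw [hFR, Matrix.mul_add, ← Matrix.mul_assoc]
      refine frob_sq_add ?_
      -- Stationarity removes the cross term: `Pᴴ P Y` lies in the ranges of `Sᴴ` and `Y`, and `R`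
      -- is orthogonal to both.
      have h1 : (P * Y)ᴴ * P = (Sᴴ * (Λ * T) + Y * (T⁻¹ * M * T))ᴴ := by
        rw [← hPY]; simp [Matrix.mul_assoc]
      rw [conjTranspose_mul, Matrix.mul_assoc, ← Matrix.mul_assoc (P * Y)ᴴ, h1,
        conjTranspose_add, conjTranspose_mul Sᴴ, conjTranspose_mul Y, conjTranspose_conjTranspose,
        Matrix.add_mul, Matrix.mul_assoc, hSR, Matrix.mul_assoc _ Yᴴ, hYR]
      simp
    have e2 : ‖P * Y‖ ^ 2 = ‖P * Y * D‖ ^ 2 + ‖P * Y * b‖ ^ 2 := by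
      rw [← frob_mul_conjTranspose_of_orthonormal hYo (P * Y), hYD, Matrix.mul_add,
        frob_sq_add', ← Matrix.mul_assoc _ b, frob_mul_conjTranspose_of_orthonormal hFo]
      rw [conjTranspose_mul, conjTranspose_mul b, conjTranspose_conjTranspose, Matrix.mul_assoc,
        ← Matrix.mul_assoc D, ← Matrix.mul_assoc D, hDF]
      simp
    have e3 : ‖F‖ ^ 2 = ‖b‖ ^ 2 + ‖R‖ ^ 2 := by
      conv_lhs => rw [hFR]
      rw [frob_sq_add, frob_mul_of_orthonormal hYo]
      rw [conjTranspose_mul, Matrix.mul_assoc, hYR, Matrix.mul_zero]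
    have e4 : ‖Yᴴ‖ ^ 2 = ‖D‖ ^ 2 + ‖b‖ ^ 2 := by
      conv_lhs => rw [hYD]
      rw [frob_sq_add', frob_mul_conjTranspose_of_orthonormal hFo]
      rw [conjTranspose_mul, conjTranspose_conjTranspose, ← Matrix.mul_assoc, hDF, Matrix.zero_mul]
    have e5 : ‖F‖ ^ 2 = ‖Yᴴ‖ ^ 2 := by
      rw [frobenius_norm_conjTranspose, frob_sq_eq_trace, frob_sq_eq_trace, hFo, hYo]
    have e6 : ‖P * Y * D‖ ^ 2 ≤ c * ‖D‖ ^ 2 := by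
      have := hle (T * D)
      rwa [← Matrix.mul_assoc (augment X), ← hY, frob_mul_of_orthonormal hYo,
        ← Matrix.mul_assoc] at this
    have e7 := hge R hSR hXR
    have e8 : ‖P * F‖ ^ 2 ≤ ‖E'‖ ^ 2 := by
      rw [← norm_neg (P * F), ← hEF]
      gcongr
      exact frob_mul_le_of_orthonormal hFo _
    refine ⟨b, T', R, hT', hF ▸ hFR, ?_⟩
    have e9 : ‖D‖ ^ 2 = ‖R‖ ^ 2 := by linarith
    rw [e9] at e6
    nlinarith
  -- The optimal correction `-P Y Yᴴ` cancels `P` on the span of `Y` and nothing else.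
  have hE0 : (P + -(P * Y * Yᴴ)) * augment X = 0 := by
    rw [hXY, Matrix.add_mul, Matrix.neg_mul, Matrix.mul_assoc (P * Y), ← Matrix.mul_assoc Yᴴ, hYo,
      Matrix.one_mul, Matrix.mul_assoc, add_neg_cancel]
  have hE0n : ‖-(P * Y * Yᴴ)‖ = ‖P * Y‖ := by
    rw [norm_neg, frob_mul_conjTranspose_of_orthonormal hYo]
  refine ⟨⟨-(P * Y * Yᴴ), ⟨hS, hE0⟩, fun X' E' h1 h2 => ?_⟩, ?_⟩
  · obtain ⟨b, T', R, -, -, h⟩ := key X' E' h1 h2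
    rw [hE0n]
    refine le_of_sq_le_sq ?_ (norm_nonneg _)
    nlinarith [mul_nonneg (sub_nonneg.2 hc.le) (sq_nonneg ‖R‖)]
  · rintro X' ⟨E', ⟨h1, h2⟩, hmin⟩
    obtain ⟨b, T', R, hT', hF, h⟩ := key X' E' h1 h2
    have h3 := hmin X _ hS hE0
    rw [hE0n] at h3
    have h4 : ‖E'‖ ^ 2 ≤ ‖P * Y‖ ^ 2 := by gcongr
    have h5 : (c' - c) * ‖R‖ ^ 2 ≤ 0 := by linarith
    have h6 : R = 0 := by
      have : ‖R‖ ^ 2 ≤ 0 := by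
        by_contra hh
        push Not at hh
        nlinarith [mul_pos (sub_pos.2 hc) hh]
      simpa using le_antisymm this (sq_nonneg _)
    rw [h6, add_zero] at hF
    have h7 : augment X' = augment X * (T * b * T'⁻¹) := by
      rw [Matrix.mul_assoc T, ← Matrix.mul_assoc, ← hY, ← Matrix.mul_assoc, ← hF, Matrix.mul_assoc,
        mul_nonsing_inv _ hT', Matrix.mul_one]
    -- Both augmented matrices end in the block `-1`, so the change of basis between them is the
    -- identity.
    have h8 : T * b * T'⁻¹ = 1 := by
      rw [← Matrix.one_mul (T * b * T'⁻¹), ← leftInv_mul_augment X, Matrix.mul_assoc, ← h7,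
        leftInv_mul_augment, leftInv_mul_augment]
    rw [h8, Matrix.mul_one] at h7
    exact augment_injective h7

end Minimality

/-! ### Stability of spectral gaps -/

section Gap

open scoped Matrix.Norms.Frobenius

variable {α β ν δ κ ι Z : Type*} [Fintype α] [Fintype β] [Fintype ν] [Fintype δ] [DecidableEq δ]
  [Fintype κ] [Fintype ι] [TopologicalSpace Z]

omit [Fintype δ] [Fintype ν] in
theorem continuous_augment : Continuous (augment : Matrix ν δ ℂ → Matrix (ν ⊕ δ) δ ℂ) := by
  refine continuous_matrix fun i j => ?_
  rcases i with i | i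
  · exact continuous_id.matrix_elem i j
  · exact continuous_const

/-- A strict homogeneous inequality on the unit sphere of matrices persists near a point. -/
theorem eventually_forall_of_sphere {z₀ : Z} {p : Z → Matrix κ ι ℂ → Prop}
    (hsmul : ∀ z r, ∀ t : ℝ, 0 < t → p z (t • r) → p z r) (hzero : ∀ z, p z 0)
    (h : ∀ r : Matrix κ ι ℂ, ‖r‖ = 1 → ∀ᶠ w : Z × Matrix κ ι ℂ in 𝓝 (z₀, r), p w.1 w.2) :
    ∀ᶠ z in 𝓝 z₀, ∀ r, p z r := by
  have hK : IsCompact (Metric.sphere (0 : Matrix κ ι ℂ) 1) := by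
    have : ProperSpace (Matrix κ ι ℂ) := FiniteDimensional.proper ℂ _
    exact isCompact_sphere _ _
  have := hK.eventually_forall_of_forall_eventually (x₀ := z₀) (P := p)
    (fun r hr => h r (by simpa using hr))
  filter_upwards [this] with z hz r
  by_cases hr : r = 0
  · exact hr ▸ hzero z
  · have hn : 0 < ‖r‖ := norm_pos_iff.2 hr
    refine hsmul z r ‖r‖⁻¹ (inv_pos.2 hn) (hz _ ?_)
    simp [norm_smul, hn.ne']

omit [DecidableEq δ] in
theorem eventually_upper_gap {P : Matrix β κ ℂ} {Y : Matrix κ δ ℂ} {c : ℝ}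
    (h : ∀ x : Matrix δ ι ℂ, x ≠ 0 → ‖P * (Y * x)‖ ^ 2 < c * ‖Y * x‖ ^ 2) :
    ∀ᶠ z : Matrix β κ ℂ × Matrix κ δ ℂ in 𝓝 (P, Y), ∀ x : Matrix δ ι ℂ,
      ‖z.1 * (z.2 * x)‖ ^ 2 ≤ c * ‖z.2 * x‖ ^ 2 := by
  refine eventually_forall_of_sphere
    (p := fun (z : Matrix β κ ℂ × Matrix κ δ ℂ) x => ‖z.1 * (z.2 * x)‖ ^ 2 ≤ c * ‖z.2 * x‖ ^ 2) ?_ ?_ ?_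
  · intro z x t ht hx
    simp only [Matrix.mul_smul, norm_smul, mul_pow, Real.norm_eq_abs, sq_abs] at hx
    have : 0 < t ^ 2 := by positivity
    nlinarith
  · simp
  · intro x hx
    have hc : ContinuousAt (fun w : (Matrix β κ ℂ × Matrix κ δ ℂ) × Matrix δ ι ℂ =>
        c * ‖w.1.2 * w.2‖ ^ 2 - ‖w.1.1 * (w.1.2 * w.2)‖ ^ 2) ((P, Y), x) := by fun_prop
    have hpos := h x (by rintro rfl; simp at hx)
    filter_upwards [hc.eventually_const_lt (u := 0) (by simpa using hpos)] with w hw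
    linarith

omit [DecidableEq δ] in
-- The kernels may vary with the data, but each equation is a closed condition: an `r` that violates
-- one at the base point violates it nearby, where the implication is vacuous.
theorem eventually_lower_gap {S : Matrix α κ ℂ} {P : Matrix β κ ℂ} {Y : Matrix κ δ ℂ} {c : ℝ}
    (h : ∀ r : Matrix κ ι ℂ, r ≠ 0 → S * r = 0 → Yᴴ * r = 0 → c * ‖r‖ ^ 2 < ‖P * r‖ ^ 2) :
    ∀ᶠ z : Matrix α κ ℂ × Matrix β κ ℂ × Matrix κ δ ℂ in 𝓝 (S, P, Y), ∀ r : Matrix κ ι ℂ,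
      z.1 * r = 0 → z.2.2ᴴ * r = 0 → c * ‖r‖ ^ 2 ≤ ‖z.2.1 * r‖ ^ 2 := by
  refine eventually_forall_of_sphere
    (p := fun (z : Matrix α κ ℂ × Matrix β κ ℂ × Matrix κ δ ℂ) r =>
      z.1 * r = 0 → z.2.2ᴴ * r = 0 → c * ‖r‖ ^ 2 ≤ ‖z.2.1 * r‖ ^ 2) ?_ ?_ ?_
  · intro z x t ht hx h1 h2
    simp only [Matrix.mul_smul, norm_smul, mul_pow, Real.norm_eq_abs, sq_abs, h1, h2, smul_zero,
      forall_const] at hx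
    have : 0 < t ^ 2 := by positivity
    nlinarith
  · simp
  · intro r hr
    have hr0 : r ≠ 0 := by rintro rfl; simp at hr
    by_cases h1 : S * r = 0
    · by_cases h2 : Yᴴ * r = 0
      · have hc : ContinuousAt
            (fun w : (Matrix α κ ℂ × Matrix β κ ℂ × Matrix κ δ ℂ) × Matrix κ ι ℂ =>
              ‖w.1.2.1 * w.2‖ ^ 2 - c * ‖w.2‖ ^ 2) ((S, P, Y), r) := by fun_prop
        have hpos := h r hr0 h1 h2
        filter_upwards [hc.eventually_const_lt (u := 0) (by simpa using hpos)] with w hw _ _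
        linarith
      · have hc : ContinuousAt
            (fun w : (Matrix α κ ℂ × Matrix β κ ℂ × Matrix κ δ ℂ) × Matrix κ ι ℂ =>
              w.1.2.2ᴴ * w.2) ((S, P, Y), r) := by fun_prop
        filter_upwards [hc.eventually_ne h2] with w hw _ h'
        exact absurd h' hw
    · have hc : ContinuousAt
          (fun w : (Matrix α κ ℂ × Matrix β κ ℂ × Matrix κ δ ℂ) × Matrix κ ι ℂ =>
            w.1.1 * w.2) ((S, P, Y), r) := by fun_prop
      filter_upwards [hc.eventually_ne h1] with w hw h'
      exact absurd h' hw

end Gap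

/-! ### The stationarity equations and their derivative -/

section Stationarity

open scoped Matrix.Norms.Frobenius

variable {α β γ ν δ : Type*} [Fintype α] [Fintype β] [Fintype γ] [Fintype ν] [Fintype δ]
  [DecidableEq δ]

/-- The derivative of a product of matrix-valued maps. -/
theorem hasStrictFDerivAt_matrix_mul {E : Type*} [NormedAddCommGroup E] [NormedSpace ℝ E]
    {f : E → Matrix α β ℂ} {g : E → Matrix β γ ℂ} {f' : E →L[ℝ] Matrix α β ℂ}
    {g' : E →L[ℝ] Matrix β γ ℂ} {x : E}
    (hf : HasStrictFDerivAt f f' x) (hg : HasStrictFDerivAt g g' x) :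
    ∃ h' : E →L[ℝ] Matrix α γ ℂ, HasStrictFDerivAt (fun y => f y * g y) h' x ∧
      ∀ v, h' v = f x * g' v + f' v * g x := by
  have hb : IsBoundedBilinearMap ℝ (fun z : Matrix α β ℂ × Matrix β γ ℂ => z.1 * z.2) :=
    { add_left := fun _ _ _ => Matrix.add_mul _ _ _
      smul_left := fun _ _ _ => Matrix.smul_mul _ _ _
      add_right := fun _ _ _ => Matrix.mul_add _ _ _
      smul_right := fun _ _ _ => Matrix.mul_smul _ _ _
      bound := ⟨1, one_pos, fun A B => by
        simpa using frobenius_norm_mul A B⟩ }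
  exact ⟨_, (hb.hasStrictFDerivAt (f x, g x)).comp x (hf.prodMk hg), fun v => rfl⟩

/-- Real-linear maps between spaces of matrices are strictly differentiable. -/
theorem hasStrictFDerivAt_linear {E F : Type*} [NormedAddCommGroup E] [NormedSpace ℝ E]
    [FiniteDimensional ℝ E] [NormedAddCommGroup F] [NormedSpace ℝ F] (f : E →ₗ[ℝ] F) (x : E) :
    HasStrictFDerivAt f f.toContinuousLinearMap x :=
  f.toContinuousLinearMap.hasStrictFDerivAt

/-- Conditions for stationarity of `X`, with the constraint multiplier `Λ` and the matrix `M` of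
`Pᴴ P` on the span of `[X; -1]`. -/
def stationarity (w : Matrix (α ⊕ β) (ν ⊕ δ) ℂ × Matrix ν δ ℂ × Matrix α δ ℂ × Matrix δ δ ℂ) :
    Matrix α δ ℂ × Matrix (ν ⊕ δ) δ ℂ :=
  (w.1.toRows₁ * augment w.2.1,
    w.1.toRows₂ᴴ * (w.1.toRows₂ * augment w.2.1) -
      (w.1.toRows₁ᴴ * w.2.2.1 + augment w.2.1 * w.2.2.2))

/-- Conjugate transposes of the data occur, so the derivative is taken over `ℝ`. It is strict, as
the implicit function theorem requires. -/
theorem hasStrictFDerivAt_stationarity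
    (w : Matrix (α ⊕ β) (ν ⊕ δ) ℂ × Matrix ν δ ℂ × Matrix α δ ℂ × Matrix δ δ ℂ) :
    ∃ L : (Matrix (α ⊕ β) (ν ⊕ δ) ℂ × Matrix ν δ ℂ × Matrix α δ ℂ × Matrix δ δ ℂ) →L[ℝ]
        Matrix α δ ℂ × Matrix (ν ⊕ δ) δ ℂ,
      HasStrictFDerivAt stationarity L w ∧ ∀ v, L v =
        (w.1.toRows₁ * fromRows v.2.1 (0 : Matrix δ δ ℂ) + v.1.toRows₁ * augment w.2.1,
          w.1.toRows₂ᴴ * (w.1.toRows₂ * fromRows v.2.1 (0 : Matrix δ δ ℂ) + v.1.toRows₂ * augment w.2.1) +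
            v.1.toRows₂ᴴ * (w.1.toRows₂ * augment w.2.1) -
          ((w.1.toRows₁ᴴ * v.2.2.1 + v.1.toRows₁ᴴ * w.2.2.1) +
            (augment w.2.1 * v.2.2.2 + fromRows v.2.1 (0 : Matrix δ δ ℂ) * w.2.2.2))) := by
  let E := Matrix (α ⊕ β) (ν ⊕ δ) ℂ × Matrix ν δ ℂ × Matrix α δ ℂ × Matrix δ δ ℂ
  have hS := hasStrictFDerivAt_linear (E := E)
    { toFun := fun v => v.1.toRows₁, map_add' := fun _ _ => rfl, map_smul' := fun _ _ => rfl } w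
  have hP := hasStrictFDerivAt_linear (E := E)
    { toFun := fun v => v.1.toRows₂, map_add' := fun _ _ => rfl, map_smul' := fun _ _ => rfl } w
  have hSH := hasStrictFDerivAt_linear (E := E)
    { toFun := fun v => v.1.toRows₁ᴴ
      map_add' := fun a b => conjTranspose_add a.1.toRows₁ b.1.toRows₁
      map_smul' := fun t a => conjTranspose_smul t a.1.toRows₁ } w
  have hPH := hasStrictFDerivAt_linear (E := E)
    { toFun := fun v => v.1.toRows₂ᴴ
      map_add' := fun a b => conjTranspose_add a.1.toRows₂ b.1.toRows₂
      map_smul' := fun t a => conjTranspose_smul t a.1.toRows₂ } w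
  have hL := hasStrictFDerivAt_linear (E := E)
    { toFun := fun v => v.2.2.1, map_add' := fun _ _ => rfl, map_smul' := fun _ _ => rfl } w
  have hM := hasStrictFDerivAt_linear (E := E)
    { toFun := fun v => v.2.2.2, map_add' := fun _ _ => rfl, map_smul' := fun _ _ => rfl } w
  let X₀ : E →ₗ[ℝ] Matrix (ν ⊕ δ) δ ℂ :=
    { toFun := fun v => fromRows v.2.1 (0 : Matrix δ δ ℂ)
      map_add' := fun a b => by ext (i | i) j <;> [rfl; simp]
      map_smul' := fun t a => by ext (i | i) j <;> [rfl; simp] }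
  have hY : HasStrictFDerivAt (fun v : E => augment v.2.1) X₀.toContinuousLinearMap w := by
    refine ((hasStrictFDerivAt_linear X₀ w).add_const (fromRows 0 (-1))).congr_of_eventuallyEq
      (Eventually.of_forall fun v => ?_)
    ext (i | i) j <;> simp [augment, X₀]
  obtain ⟨L1, h1, e1⟩ := hasStrictFDerivAt_matrix_mul hS hY
  obtain ⟨L2, h2, e2⟩ := hasStrictFDerivAt_matrix_mul hP hY
  obtain ⟨L3, h3, e3⟩ := hasStrictFDerivAt_matrix_mul hPH h2
  obtain ⟨L4, h4, e4⟩ := hasStrictFDerivAt_matrix_mul hSH hL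
  obtain ⟨L5, h5, e5⟩ := hasStrictFDerivAt_matrix_mul hY hM
  refine ⟨_, h1.prodMk (h3.sub (h4.add h5)), fun v => ?_⟩
  change (L1 v, L3 v - (L4 v + L5 v)) = _
  rw [e1, e3, e2, e4, e5]
  rfl

end Stationarity

/-! ### Spectral data of a total least squares problem -/

section Spectral

open scoped Matrix.Norms.Frobenius

variable {α β γ ν δ ι : Type*} [Fintype α] [DecidableEq α] [Fintype β] [Fintype γ] [DecidableEq γ]
  [Fintype ν] [DecidableEq ν] [Fintype δ] [DecidableEq δ]

omit [Fintype α] in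
theorem rdiag_conjTranspose (s : α → ℝ) : (rdiag s)ᴴ = rdiag s := by
  simp [rdiag, diagonal_conjTranspose, Pi.star_def]

theorem rdiag_mul_apply (s : α → ℝ) (x : Matrix α ι ℂ) (i : α) (j : ι) :
    (rdiag s * x) i j = s i * x i j := by
  simp [rdiag]

theorem mul_rdiag_apply (s : α → ℝ) (x : Matrix ι α ℂ) (i : ι) (j : α) :
    (x * rdiag s) i j = x i j * s j := by
  simp [rdiag]

omit [DecidableEq ν] [DecidableEq δ] in
theorem toRows₁_conjTranspose_mul (A : Matrix (ν ⊕ δ) ι ℂ) (X : Matrix ν δ ℂ) :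
    A.toRows₁ᴴ * X = Aᴴ * fromRows X (0 : Matrix δ δ ℂ) := by
  conv_rhs => rw [← fromRows_toRows A, conjTranspose_fromRows_eq_fromCols_conjTranspose,
    fromCols_mul_fromRows, Matrix.mul_zero, add_zero]

theorem frob_rdiag_mul_sq [Fintype ι] (s : α → ℝ) (x : Matrix α ι ℂ) :
    ‖rdiag s * x‖ ^ 2 = ∑ i, ∑ j, s i ^ 2 * ‖x i j‖ ^ 2 := by
  simp [frob_sq_eq_sum, rdiag_mul_apply, mul_pow]

theorem frob_rdiag_mul_sq_lt [Fintype ι] {s : α → ℝ} {c : ℝ} (hs : ∀ i, s i ^ 2 < c) {x : Matrix α ι ℂ}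
    (hx : x ≠ 0) : ‖rdiag s * x‖ ^ 2 < c * ‖x‖ ^ 2 := by
  obtain ⟨i, j, hij⟩ : ∃ i j, x i j ≠ 0 := by
    by_contra! h
    exact hx (Matrix.ext h)
  rw [frob_rdiag_mul_sq, frob_sq_eq_sum, Finset.mul_sum]
  simp_rw [Finset.mul_sum]
  refine Finset.sum_lt_sum (fun i _ => Finset.sum_le_sum fun j _ => ?_)
    ⟨i, Finset.mem_univ _, Finset.sum_lt_sum (fun j _ => ?_) ⟨j, Finset.mem_univ _, ?_⟩⟩
  · exact mul_le_mul_of_nonneg_right (hs _).le (by positivity)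
  · exact mul_le_mul_of_nonneg_right (hs _).le (by positivity)
  · exact mul_lt_mul_of_pos_right (hs _) (by positivity)

theorem lt_frob_rdiag_mul_sq [Fintype ι] {s : α → ℝ} {c : ℝ} (hs : ∀ i, c < s i ^ 2) {x : Matrix α ι ℂ}
    (hx : x ≠ 0) : c * ‖x‖ ^ 2 < ‖rdiag s * x‖ ^ 2 := by
  obtain ⟨i, j, hij⟩ : ∃ i j, x i j ≠ 0 := by
    by_contra! h
    exact hx (Matrix.ext h)
  rw [frob_rdiag_mul_sq, frob_sq_eq_sum, Finset.mul_sum]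
  simp_rw [Finset.mul_sum]
  refine Finset.sum_lt_sum (fun i _ => Finset.sum_le_sum fun j _ => ?_)
    ⟨i, Finset.mem_univ _, Finset.sum_lt_sum (fun j _ => ?_) ⟨j, Finset.mem_univ _, ?_⟩⟩
  · exact mul_le_mul_of_nonneg_right (hs _).le (by positivity)
  · exact mul_le_mul_of_nonneg_right (hs _).le (by positivity)
  · exact mul_lt_mul_of_pos_right (hs _) (by positivity)

/-- Singular vectors and values attached to the pair `(S, P)`: an orthonormal basis
`[Vs, V₁, V₂]` in which `S` vanishes on `V₁, V₂`, and `P` restricted to the kernel of `S` is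
diagonal with separated singular values `σ₁`, `σ₂`. -/
structure SpectralData (S : Matrix α (ν ⊕ δ) ℂ) (P : Matrix β (ν ⊕ δ) ℂ)
    (Us : Matrix α α ℂ) (s : α → ℝ) (Vs : Matrix (ν ⊕ δ) α ℂ)
    (U₁ : Matrix β γ ℂ) (σ₁ : γ → ℝ) (V₁ : Matrix (ν ⊕ δ) γ ℂ)
    (U₂ : Matrix β δ ℂ) (σ₂ : δ → ℝ) (V₂ : Matrix (ν ⊕ δ) δ ℂ)
    (Sd : Matrix (ν ⊕ δ) α ℂ) : Prop where
  vs_vs : Vsᴴ * Vs = 1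
  vs_v₁ : Vsᴴ * V₁ = 0
  v₁_v₁ : V₁ᴴ * V₁ = 1
  vs_v₂ : Vsᴴ * V₂ = 0
  v₁_v₂ : V₁ᴴ * V₂ = 0
  v₂_v₂ : V₂ᴴ * V₂ = 1
  complete : Vs * Vsᴴ + V₁ * V₁ᴴ + V₂ * V₂ᴴ = 1
  us_left : Usᴴ * Us = 1
  us_right : Us * Usᴴ = 1
  s_pos : ∀ i, 0 < s i
  s_factor : S = Us * rdiag s * Vsᴴ
  p_v₁ : P * V₁ = U₁ * rdiag σ₁
  p_v₂ : P * V₂ = U₂ * rdiag σ₂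
  u₁_u₁ : U₁ᴴ * U₁ = 1
  u₁_u₂ : U₁ᴴ * U₂ = 0
  u₂_u₂ : U₂ᴴ * U₂ = 1
  σ₂_pos : ∀ j, 0 < σ₂ j
  gap : ∀ i j, σ₂ j < σ₁ i
  sd_us : Sd * (Us * rdiag s) = Vs
  s_sd : S * Sd = 1
  unit : IsUnit V₂.toRows₂.det

namespace SpectralData

variable {S : Matrix α (ν ⊕ δ) ℂ} {P : Matrix β (ν ⊕ δ) ℂ}
    {Us : Matrix α α ℂ} {s : α → ℝ} {Vs : Matrix (ν ⊕ δ) α ℂ}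
    {U₁ : Matrix β γ ℂ} {σ₁ : γ → ℝ} {V₁ : Matrix (ν ⊕ δ) γ ℂ}
    {U₂ : Matrix β δ ℂ} {σ₂ : δ → ℝ} {V₂ : Matrix (ν ⊕ δ) δ ℂ}
    {Sd : Matrix (ν ⊕ δ) α ℂ}

/-- The solution `X = -V₁₂ V₂₂⁻¹`. -/
def sol (V₂ : Matrix (ν ⊕ δ) δ ℂ) : Matrix ν δ ℂ := -(V₂.toRows₁ * V₂.toRows₂⁻¹)

section
variable (h : SpectralData S P Us s Vs U₁ σ₁ V₁ U₂ σ₂ V₂ Sd)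
include h

theorem augment_sol : augment (sol V₂) = -(V₂ * V₂.toRows₂⁻¹) := by
  rw [← fromRows_toRows V₂, fromRows_mul, augment, sol]
  simp only [toRows₁_fromRows, toRows₂_fromRows]
  rw [mul_nonsing_inv _ h.unit]
  ext (i | i) j <;> simp

theorem s_v₂ : S * V₂ = 0 := by
  rw [h.s_factor, Matrix.mul_assoc, h.vs_v₂, Matrix.mul_zero]

theorem s_v₁ : S * V₁ = 0 := by
  rw [h.s_factor, Matrix.mul_assoc, h.vs_v₁, Matrix.mul_zero]

theorem s_augment_sol : S * augment (sol V₂) = 0 := by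
  rw [h.augment_sol, Matrix.mul_neg, ← Matrix.mul_assoc, h.s_v₂, Matrix.zero_mul, neg_zero]

theorem sd_s : Sd * S = Vs * Vsᴴ := by
  rw [h.s_factor, ← Matrix.mul_assoc, h.sd_us]

theorem v₁_p : V₁ᴴ * Pᴴ = rdiag σ₁ * U₁ᴴ := by
  rw [← conjTranspose_mul, h.p_v₁, conjTranspose_mul, rdiag_conjTranspose]

theorem v₂_p : V₂ᴴ * Pᴴ = rdiag σ₂ * U₂ᴴ := by
  rw [← conjTranspose_mul, h.p_v₂, conjTranspose_mul, rdiag_conjTranspose]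

/-- Expand `Pᴴ P V₂` in the basis `[Vs, V₁, V₂]`. The `V₁` component vanishes because `U₁` is
orthogonal to `U₂`, the `V₂` component is `Σ₂²`, and the `Vs` component lies in the range of `Sᴴ`
because `Sᴴ Sdᴴ = Vs Vsᴴ`. -/
theorem gram_v₂ : Pᴴ * (P * V₂) =
    Sᴴ * (Sdᴴ * (Pᴴ * (U₂ * rdiag σ₂))) + V₂ * (rdiag σ₂ * rdiag σ₂) := by
  have h1 : Sᴴ * Sdᴴ = Vs * Vsᴴ := by
    rw [← conjTranspose_mul, h.sd_s, conjTranspose_mul, conjTranspose_conjTranspose]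
  have h2 : Pᴴ * (U₂ * rdiag σ₂) = (Vs * Vsᴴ + V₁ * V₁ᴴ + V₂ * V₂ᴴ) * (Pᴴ * (U₂ * rdiag σ₂)) := by
    rw [h.complete, Matrix.one_mul]
  have h3 : V₁ᴴ * (Pᴴ * (U₂ * rdiag σ₂)) = 0 := by
    rw [← Matrix.mul_assoc, h.v₁_p, Matrix.mul_assoc, ← Matrix.mul_assoc U₁ᴴ, h.u₁_u₂]
    simp
  have h4 : V₂ᴴ * (Pᴴ * (U₂ * rdiag σ₂)) = rdiag σ₂ * rdiag σ₂ := by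
    rw [← Matrix.mul_assoc, h.v₂_p, Matrix.mul_assoc, ← Matrix.mul_assoc U₂ᴴ, h.u₂_u₂,
      Matrix.one_mul]
  rw [h.p_v₂, ← Matrix.mul_assoc Sᴴ, h1]
  conv_lhs => rw [h2]
  rw [Matrix.add_mul, Matrix.add_mul, Matrix.mul_assoc V₁, h3, Matrix.mul_assoc V₂, h4,
    Matrix.mul_zero, add_zero]

/-- Stationarity of the solution, with explicit multipliers. -/
theorem gram_augment_sol : Pᴴ * (P * augment (sol V₂)) =
    Sᴴ * (-(Sdᴴ * (Pᴴ * (U₂ * rdiag σ₂))) * V₂.toRows₂⁻¹) +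
      augment (sol V₂) * (V₂.toRows₂ * (rdiag σ₂ * rdiag σ₂) * V₂.toRows₂⁻¹) := by
  have h1 : V₂ * V₂.toRows₂⁻¹ * (V₂.toRows₂ * (rdiag σ₂ * rdiag σ₂) * V₂.toRows₂⁻¹) =
      V₂ * (rdiag σ₂ * rdiag σ₂) * V₂.toRows₂⁻¹ := by
    simp only [Matrix.mul_assoc]
    rw [← Matrix.mul_assoc _ V₂.toRows₂, nonsing_inv_mul _ h.unit, Matrix.one_mul]
  rw [h.augment_sol, Matrix.neg_mul (V₂ * V₂.toRows₂⁻¹), h1, Matrix.mul_neg, ← Matrix.mul_assoc P, Matrix.mul_neg,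
    ← Matrix.mul_assoc Pᴴ, h.gram_v₂, Matrix.add_mul, neg_add, Matrix.neg_mul, Matrix.mul_neg,
    Matrix.mul_assoc Sᴴ]

/-- `[X; -1]` spans the columns of `V₂`, and what remains of `ker S` is spanned by `V₁`. Any `c <
c'` strictly between the squares of `σ₂` and those of `σ₁` will do. -/
theorem exists_gap : ∃ c c' : ℝ, c < c' ∧
    (∀ x : Matrix δ (ν ⊕ δ) ℂ, x ≠ 0 →
      ‖P * (augment (sol V₂) * x)‖ ^ 2 < c * ‖augment (sol V₂) * x‖ ^ 2) ∧
    ∀ r : Matrix (ν ⊕ δ) δ ℂ, r ≠ 0 → S * r = 0 → (augment (sol V₂))ᴴ * r = 0 →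
      c' * ‖r‖ ^ 2 < ‖P * r‖ ^ 2 := by
  -- Separating finite sets also covers an empty family `σ₁` or `σ₂`.
  obtain ⟨c, hc2, hc1⟩ := Order.exists_between_finsets
    (Finset.univ.image fun j => σ₂ j ^ 2) (Finset.univ.image fun i => σ₁ i ^ 2) (by
      simp only [Finset.mem_image, Finset.mem_univ, true_and]
      rintro _ ⟨j, rfl⟩ _ ⟨i, rfl⟩
      have := h.gap i j
      have := h.σ₂_pos j
      gcongr)
  obtain ⟨c', hc', hc1'⟩ := Order.exists_between_finsets {c}
    (Finset.univ.image fun i => σ₁ i ^ 2) (by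
      intro x hx
      rw [Finset.mem_singleton] at hx
      exact hx ▸ hc1)
  simp only [Finset.mem_image, Finset.mem_univ, true_and, forall_exists_index,
    forall_apply_eq_imp_iff, Finset.mem_singleton, forall_eq] at hc2 hc' hc1'
  have hu := isUnit_nonsing_inv_det _ h.unit
  refine ⟨c, c', hc', fun x hx => ?_, fun r hr hSr hYr => ?_⟩
  · have hx' : V₂.toRows₂⁻¹ * x ≠ 0 := fun h0 => hx <| by
      rw [← Matrix.one_mul x, ← mul_nonsing_inv _ h.unit, Matrix.mul_assoc, h0, Matrix.mul_zero]
    have e : augment (sol V₂) * x = V₂ * -(V₂.toRows₂⁻¹ * x) := by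
      rw [h.augment_sol, Matrix.neg_mul, Matrix.mul_assoc, Matrix.mul_neg]
    rw [e, ← Matrix.mul_assoc, h.p_v₂, Matrix.mul_assoc, frob_mul_of_orthonormal h.u₂_u₂,
      frob_mul_of_orthonormal h.v₂_v₂]
    exact frob_rdiag_mul_sq_lt hc2 (neg_ne_zero.2 hx')
  · have h1 : Vsᴴ * r = 0 := by
      have h2 : Vsᴴ = rdiag (fun i => (s i)⁻¹) * (Usᴴ * S) := by
        rw [h.s_factor, Matrix.mul_assoc Us, ← Matrix.mul_assoc Usᴴ, h.us_left, Matrix.one_mul,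
          ← Matrix.mul_assoc, rdiag, rdiag, diagonal_mul_diagonal]
        have : (fun i => ((s i)⁻¹ : ℝ) * (s i : ℂ)) = fun _ => 1 := by
          funext i
          have := (h.s_pos i).ne'
          rw [← Complex.ofReal_mul, inv_mul_cancel₀ this, Complex.ofReal_one]
        rw [this, diagonal_one, Matrix.one_mul]
      rw [h2, Matrix.mul_assoc, Matrix.mul_assoc, hSr, Matrix.mul_zero, Matrix.mul_zero]
    have h2 : V₂ᴴ * r = 0 := by
      have : V₂ = -(augment (sol V₂) * V₂.toRows₂) := by
        rw [h.augment_sol, Matrix.neg_mul, Matrix.mul_assoc, nonsing_inv_mul _ h.unit]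
        simp
      rw [this, conjTranspose_neg, conjTranspose_mul, Matrix.neg_mul, Matrix.mul_assoc, hYr]
      simp
    have h3 : r = V₁ * (V₁ᴴ * r) := by
      conv_lhs => rw [← Matrix.one_mul r, ← h.complete]
      rw [Matrix.add_mul, Matrix.add_mul, Matrix.mul_assoc, h1, Matrix.mul_assoc,
        Matrix.mul_assoc, h2]
      simp
    have h4 : V₁ᴴ * r ≠ 0 := fun h0 => hr (by rw [h3, h0, Matrix.mul_zero])
    rw [h3, ← Matrix.mul_assoc P, h.p_v₁, Matrix.mul_assoc, frob_mul_of_orthonormal h.u₁_u₁,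
      frob_mul_of_orthonormal h.v₁_v₁]
    exact lt_frob_rdiag_mul_sq hc1' h4

/-- `[1, X]` annihilates `V₂`, hence `[1, X] = [1, X] W Wᴴ` with `W = [Vs, V₁]`. The first block
column of this identity exhibits `[1, X] W` as the inverse of `W₁ᴴ`. -/
theorem leftInv_w₁ : fromCols (1 : Matrix ν ν ℂ) (sol V₂) * fromCols Vs V₁ * (fromCols Vs V₁).toRows₁ᴴ = 1 := by
  have h1 : (1 : Matrix (ν ⊕ δ) (ν ⊕ δ) ℂ) = fromCols Vs V₁ * (fromCols Vs V₁)ᴴ + V₂ * V₂ᴴ := by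
    rw [conjTranspose_fromCols_eq_fromRows_conjTranspose, fromCols_mul_fromRows, h.complete]
  have h2 : fromCols (1 : Matrix ν ν ℂ) (sol V₂) * V₂ = 0 := by
    conv_lhs => rw [← fromRows_toRows V₂]
    rw [fromCols_mul_fromRows, sol, toRows₁_fromRows, toRows₂_fromRows, Matrix.neg_mul,
      Matrix.mul_assoc, nonsing_inv_mul _ h.unit]
    simp
  have h3 : fromCols (1 : Matrix ν ν ℂ) (sol V₂) =
      fromCols (1 : Matrix ν ν ℂ) (sol V₂) * fromCols Vs V₁ * (fromCols Vs V₁)ᴴ := by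
    conv_lhs => rw [← Matrix.mul_one (fromCols (1 : Matrix ν ν ℂ) (sol V₂)), h1]
    rw [Matrix.mul_add, ← Matrix.mul_assoc _ V₂, h2, Matrix.zero_mul, add_zero, Matrix.mul_assoc]
  have h4 := congrArg toCols₁ h3
  rw [toCols₁_fromCols] at h4
  exact h4.symm

theorem mul_sq_sub_ne (i : γ) (j : δ) : ((σ₁ i : ℂ) ^ 2 - (σ₂ j : ℂ) ^ 2) ≠ 0 := by
  have h1 := h.gap i j
  have h2 := h.σ₂_pos j
  have : (0 : ℝ) < σ₁ i ^ 2 - σ₂ j ^ 2 := by nlinarith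
  exact_mod_cast this.ne'

theorem mul_augment_sol_mul (A : Matrix ι (ν ⊕ δ) ℂ) :
    A * augment (sol V₂) * V₂.toRows₂ = -(A * V₂) := by
  rw [h.augment_sol, Matrix.mul_neg, Matrix.neg_mul, Matrix.mul_assoc, Matrix.mul_assoc,
    nonsing_inv_mul _ h.unit, Matrix.mul_one]

/-- First-order conditions for a perturbation of the stationarity equations. -/
theorem linearized {ΔS : Matrix α (ν ⊕ δ) ℂ} {ΔP : Matrix β (ν ⊕ δ) ℂ} {dX : Matrix ν δ ℂ}
    {dΛ : Matrix α δ ℂ} {dM : Matrix δ δ ℂ}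
    (e₁ : S * fromRows dX (0 : Matrix δ δ ℂ) + ΔS * augment (sol V₂) = 0)
    (e₂ : Pᴴ * (P * fromRows dX (0 : Matrix δ δ ℂ) + ΔP * augment (sol V₂)) + ΔPᴴ * (P * augment (sol V₂)) -
      ((Sᴴ * dΛ + ΔSᴴ * (-(Sdᴴ * (Pᴴ * (U₂ * rdiag σ₂))) * V₂.toRows₂⁻¹)) +
        (augment (sol V₂) * dM +
          fromRows dX (0 : Matrix δ δ ℂ) * (V₂.toRows₂ * (rdiag σ₂ * rdiag σ₂) * V₂.toRows₂⁻¹))) = 0) :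
    rdiag s * (Vs.toRows₁ᴴ * dX * V₂.toRows₂) = Usᴴ * (ΔS * V₂) ∧
    rdiag σ₁ * (rdiag σ₁ * (V₁.toRows₁ᴴ * dX * V₂.toRows₂)) -
      V₁.toRows₁ᴴ * dX * V₂.toRows₂ * (rdiag σ₂ * rdiag σ₂) =
      V₁ᴴ * ((ΔPᴴ - ΔSᴴ * (P * Sd)ᴴ) * (U₂ * rdiag σ₂)) +
      rdiag σ₁ * (U₁ᴴ * (ΔP * V₂) - U₁ᴴ * (P * Sd) * Us * (Usᴴ * (ΔS * V₂))) := by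
  set G := V₂.toRows₂ with hG
  have hunit := h.unit
  rw [← hG] at hunit
  set e := fromRows dX (0 : Matrix δ δ ℂ) with he
  have haug₁ := h.mul_augment_sol_mul ΔS
  have haug₂ := h.mul_augment_sol_mul ΔP
  have haug₃ := h.mul_augment_sol_mul P
  rw [← hG] at haug₁ haug₂ haug₃
  rw [toRows₁_conjTranspose_mul, toRows₁_conjTranspose_mul, ← he]
  clear_value e G
  have hdec : e * G = Vs * (Vsᴴ * e * G) + V₁ * (V₁ᴴ * e * G) + V₂ * (V₂ᴴ * e * G) := by
    conv_lhs => rw [← Matrix.one_mul (e * G), ← h.complete]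
    simp only [Matrix.add_mul, Matrix.mul_assoc]
  have f₁ : S * (e * G) = ΔS * V₂ := by
    have := congrArg (· * G) e₁
    simp only [Matrix.add_mul, haug₁, Matrix.zero_mul, Matrix.mul_assoc] at this
    rwa [← sub_eq_add_neg, sub_eq_zero] at this
  have hs : rdiag s * (Vsᴴ * e * G) = Usᴴ * (ΔS * V₂) := by
    rw [← f₁, h.s_factor]
    simp only [Matrix.mul_assoc]
    rw [← Matrix.mul_assoc Usᴴ, h.us_left, Matrix.one_mul]
  refine ⟨hs, ?_⟩
  -- Multiplying by `V₁ᴴ` on the left and `V₂₂` on the right eliminates both multipliers, since `S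
  -- V₁ = 0` and `V₁ᴴ V₂ = 0`.
  have f₂ := congrArg (fun A => V₁ᴴ * (A * G)) e₂
  have g₁ : V₁ᴴ * (Sᴴ * dΛ * G) = 0 := by
    rw [← Matrix.mul_assoc, ← Matrix.mul_assoc, ← conjTranspose_mul, h.s_v₁]
    simp
  have g₂ : V₁ᴴ * (augment (sol V₂) * dM * G) = 0 := by
    rw [h.augment_sol, Matrix.neg_mul, Matrix.neg_mul, Matrix.mul_neg]
    simp only [← Matrix.mul_assoc, h.v₁_v₂, Matrix.zero_mul, neg_zero]
  -- The `Vs` component of the unknown is already fixed by the constraint; this produces the term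
  -- with `P S†`.
  have g₃ : V₁ᴴ * (Pᴴ * (P * e) * G) =
      rdiag σ₁ * (U₁ᴴ * (P * Sd) * Us * (Usᴴ * (ΔS * V₂))) +
        rdiag σ₁ * (rdiag σ₁ * (V₁ᴴ * e * G)) := by
    have hPV : P * (e * G) = P * Sd * Us * (rdiag s * (Vsᴴ * e * G)) +
        U₁ * (rdiag σ₁ * (V₁ᴴ * e * G)) + U₂ * (rdiag σ₂ * (V₂ᴴ * e * G)) := by
      conv_lhs => rw [hdec]
      rw [Matrix.mul_add, Matrix.mul_add, ← Matrix.mul_assoc P V₁, h.p_v₁, ← Matrix.mul_assoc P V₂,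
        h.p_v₂]
      have hPs : P * Vs = P * Sd * Us * rdiag s := by
        rw [← h.sd_us]
        simp only [Matrix.mul_assoc]
      rw [← Matrix.mul_assoc P Vs, hPs]
      simp only [Matrix.mul_assoc]
    rw [Matrix.mul_assoc Pᴴ, Matrix.mul_assoc P, hPV, hs, ← Matrix.mul_assoc, h.v₁_p,
      Matrix.mul_assoc, Matrix.mul_add U₁ᴴ, Matrix.mul_add U₁ᴴ, ← Matrix.mul_assoc U₁ᴴ U₁, h.u₁_u₁,
      ← Matrix.mul_assoc U₁ᴴ U₂, h.u₁_u₂, Matrix.mul_add, Matrix.mul_add]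
    simp [Matrix.mul_assoc]
  have g₄ : V₁ᴴ * (Pᴴ * (ΔP * augment (sol V₂)) * G) = -(rdiag σ₁ * (U₁ᴴ * (ΔP * V₂))) := by
    rw [Matrix.mul_assoc Pᴴ, haug₂, Matrix.mul_neg, Matrix.mul_neg, ← Matrix.mul_assoc V₁ᴴ, h.v₁_p,
      Matrix.mul_assoc]
  have g₅ : V₁ᴴ * (ΔPᴴ * (P * augment (sol V₂)) * G) = -(V₁ᴴ * (ΔPᴴ * (U₂ * rdiag σ₂))) := by
    rw [Matrix.mul_assoc ΔPᴴ, haug₃, Matrix.mul_neg, Matrix.mul_neg, h.p_v₂]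
  have g₆ : V₁ᴴ * (ΔSᴴ * (-(Sdᴴ * (Pᴴ * (U₂ * rdiag σ₂))) * G⁻¹) * G) =
      -(V₁ᴴ * (ΔSᴴ * ((P * Sd)ᴴ * (U₂ * rdiag σ₂)))) := by
    rw [Matrix.mul_assoc ΔSᴴ, Matrix.mul_assoc _ G⁻¹, nonsing_inv_mul _ hunit, Matrix.mul_one,
      conjTranspose_mul]
    simp only [Matrix.mul_assoc, Matrix.mul_neg]
  have g₇ : V₁ᴴ * (e * (G * (rdiag σ₂ * rdiag σ₂) * G⁻¹) * G) =
      V₁ᴴ * e * G * (rdiag σ₂ * rdiag σ₂) := by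
    simp only [Matrix.mul_assoc, nonsing_inv_mul _ hunit, Matrix.mul_one]
  simp only [Matrix.add_mul, Matrix.sub_mul, Matrix.mul_add, Matrix.mul_sub, Matrix.zero_mul,
    Matrix.mul_zero, g₁, g₂, g₃, g₄, g₅, g₆, g₇] at f₂
  simp only [Matrix.sub_mul, Matrix.mul_sub, Matrix.mul_assoc] at f₂ ⊢
  rw [← sub_eq_zero, ← f₂]
  abel

end

end SpectralData

end Spectral

/-- The implicit function theorem for an equation `f (x, y) = 0` between finite-dimensional spaces,
with equally many unknowns and equations and injective partial derivative. -/
theorem exists_implicit_solution {E₁ E₂ F : Type*}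
    [NormedAddCommGroup E₁] [NormedSpace ℝ E₁] [FiniteDimensional ℝ E₁]
    [NormedAddCommGroup E₂] [NormedSpace ℝ E₂] [FiniteDimensional ℝ E₂]
    [NormedAddCommGroup F] [NormedSpace ℝ F] [FiniteDimensional ℝ F]
    {f : E₁ × E₂ → F} {L : E₁ × E₂ →L[ℝ] F} {a : E₁ × E₂} (hL : HasStrictFDerivAt f L a)
    (hinj : ∀ u, L (0, u) = 0 → u = 0) (hdim : Module.finrank ℝ E₂ = Module.finrank ℝ F)
    (h0 : f a = 0) :
    ∃ (ψ : E₁ → E₂) (ψ' : E₁ →L[ℝ] E₂), HasFDerivAt ψ ψ' a.1 ∧ Tendsto ψ (𝓝 a.1) (𝓝 a.2) ∧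
      (∀ᶠ x in 𝓝 a.1, f (x, ψ x) = 0) ∧ ∀ v, L (v, ψ' v) = 0 := by
  have := FiniteDimensional.complete ℝ E₁
  have := FiniteDimensional.complete ℝ E₂
  have := FiniteDimensional.complete ℝ F
  have hinj' : Function.Injective (L ∘L .inr ℝ E₁ E₂).toLinearMap :=
    (injective_iff_map_eq_zero _).2 hinj
  have hinv : (L ∘L .inr ℝ E₁ E₂).IsInvertible :=
    ⟨(LinearMap.linearEquivOfInjective _ hinj' hdim).toContinuousLinearEquiv, rfl⟩
  refine ⟨_, _, (hL.hasStrictFDerivAt_implicitFunctionOfProdDomain hinv).hasFDerivAt,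
    hL.tendsto_implicitFunctionOfProdDomain hinv, ?_, fun v => ?_⟩
  · simpa only [h0] using hL.eventually_apply_implicitFunctionOfProdDomain hinv
  · obtain ⟨e, he⟩ := hinv
    have h1 : ∀ u, L (v, u) = L (v, 0) + e u := by
      intro u
      have : e u = L (0, u) := DFunLike.congr_fun he u
      rw [this, ← map_add]
      simp
    rw [h1, ← he, ContinuousLinearMap.inverse_equiv]
    simp

/-! ### The solution as a differentiable function of the data -/

section SolutionMap

open scoped Matrix.Norms.Frobenius

variable {α β γ ν δ : Type*} [Fintype α] [DecidableEq α] [Fintype β] [Fintype γ] [DecidableEq γ]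
  [Fintype ν] [DecidableEq ν] [Fintype δ] [DecidableEq δ]

namespace SpectralData

variable {S : Matrix α (ν ⊕ δ) ℂ} {P : Matrix β (ν ⊕ δ) ℂ}
    {Us : Matrix α α ℂ} {s : α → ℝ} {Vs : Matrix (ν ⊕ δ) α ℂ}
    {U₁ : Matrix β γ ℂ} {σ₁ : γ → ℝ} {V₁ : Matrix (ν ⊕ δ) γ ℂ}
    {U₂ : Matrix β δ ℂ} {σ₂ : δ → ℝ} {V₂ : Matrix (ν ⊕ δ) δ ℂ}
    {Sd : Matrix (ν ⊕ δ) α ℂ}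

section
variable (h : SpectralData S P Us s Vs U₁ σ₁ V₁ U₂ σ₂ V₂ Sd)
include h

/-- A matrix `dX` is recovered from the two blocks of `W₁ᴴ dX V₂₂`, where `W = [Vs, V₁]`. -/
theorem eq_of_coordinates (dX : Matrix ν δ ℂ) :
    dX = fromCols (1 : Matrix ν ν ℂ) (sol V₂) * fromCols Vs V₁ *
      fromRows (Vs.toRows₁ᴴ * dX * V₂.toRows₂) (V₁.toRows₁ᴴ * dX * V₂.toRows₂) *
      V₂.toRows₂⁻¹ := by
  have h1 : fromRows (Vs.toRows₁ᴴ * dX * V₂.toRows₂) (V₁.toRows₁ᴴ * dX * V₂.toRows₂) =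
      (fromCols Vs V₁).toRows₁ᴴ * dX * V₂.toRows₂ := by
    rw [← fromRows_mul, ← fromRows_mul]
    congr 2
    ext (i | i) j <;> rfl
  rw [h1, Matrix.mul_assoc, Matrix.mul_assoc _ V₂.toRows₂, mul_nonsing_inv _ h.unit,
    Matrix.mul_one, ← Matrix.mul_assoc, h.leftInv_w₁, Matrix.one_mul]

/-- Without data perturbation the scalar equations have zero right-hand side and nonzero
coefficients `s` and `σ₁² - σ₂²`, so `dX = 0`. Then `V₂ᴴ` isolates `dM`, and `Sdᴴ` isolates `dΛ`. -/
theorem linearized_injective {dX : Matrix ν δ ℂ} {dΛ : Matrix α δ ℂ} {dM : Matrix δ δ ℂ}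
    (e₁ : S * fromRows dX (0 : Matrix δ δ ℂ) = 0)
    (e₂ : Pᴴ * (P * fromRows dX (0 : Matrix δ δ ℂ)) - (Sᴴ * dΛ + (augment (sol V₂) * dM +
          fromRows dX (0 : Matrix δ δ ℂ) *
            (V₂.toRows₂ * (rdiag σ₂ * rdiag σ₂) * V₂.toRows₂⁻¹))) = 0) :
    dX = 0 ∧ dΛ = 0 ∧ dM = 0 := by
  obtain ⟨f₁, f₂⟩ := h.linearized (ΔS := 0) (ΔP := 0) (dX := dX) (dΛ := dΛ) (dM := dM)
    (by simpa using e₁) (by simpa using e₂)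
  simp only [Matrix.zero_mul, Matrix.mul_zero, conjTranspose_zero, sub_zero, add_zero] at f₁ f₂
  have g₁ : Vs.toRows₁ᴴ * dX * V₂.toRows₂ = 0 := by
    ext i j
    have := congrFun (congrFun f₁ i) j
    rw [rdiag_mul_apply] at this
    exact (mul_eq_zero.1 this).resolve_left (by exact_mod_cast (h.s_pos i).ne')
  have g₂ : V₁.toRows₁ᴴ * dX * V₂.toRows₂ = 0 := by
    ext i j
    have := congrFun (congrFun f₂ i) j
    rw [Matrix.sub_apply, rdiag_mul_apply, rdiag_mul_apply, ← Matrix.mul_assoc, mul_rdiag_apply,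
      mul_rdiag_apply] at this
    refine (mul_eq_zero.1 (?_ : ((σ₁ i : ℂ) ^ 2 - (σ₂ j : ℂ) ^ 2) * _ = 0)).resolve_left
      (h.mul_sq_sub_ne i j)
    rw [← (by simpa using this : _ = (0 : ℂ))]
    ring
  have hX : dX = 0 := by
    rw [h.eq_of_coordinates dX, g₁, g₂, fromRows_zero]
    simp
  refine ⟨hX, ?_⟩
  have e₃ : Sᴴ * dΛ + augment (sol V₂) * dM = 0 := by
    rw [hX, fromRows_zero, Matrix.mul_zero, Matrix.mul_zero, Matrix.zero_mul, add_zero, zero_sub,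
      neg_eq_zero] at e₂
    exact e₂
  have hM : dM = 0 := by
    have := congrArg (fun A => V₂.toRows₂ * (V₂ᴴ * A)) e₃
    simp only [Matrix.mul_add, Matrix.mul_zero] at this
    rw [← Matrix.mul_assoc V₂ᴴ, ← conjTranspose_mul, h.s_v₂, h.augment_sol, Matrix.neg_mul,
      Matrix.mul_assoc V₂, Matrix.mul_neg, ← Matrix.mul_assoc V₂ᴴ, h.v₂_v₂, Matrix.one_mul,
      Matrix.mul_neg, ← Matrix.mul_assoc _ _ dM, mul_nonsing_inv _ h.unit] at this
    simpa using this
  refine ⟨?_, hM⟩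
  have := congrArg (fun A => Sdᴴ * A) e₃
  simp only [hM, Matrix.mul_zero, add_zero] at this
  rwa [← Matrix.mul_assoc, ← conjTranspose_mul, h.s_sd, conjTranspose_one, Matrix.one_mul] at this

/-- Near the given data the unique solution is a differentiable function of the data, whose
derivative satisfies the linearized stationarity equations. -/
theorem exists_solution_map :
    ∃ (φ : Matrix (α ⊕ β) (ν ⊕ δ) ℂ → Matrix ν δ ℂ)
      (φ' : Matrix (α ⊕ β) (ν ⊕ δ) ℂ →L[ℝ] Matrix ν δ ℂ),
      HasFDerivAt φ φ' (fromRows S P) ∧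
      (∀ᶠ N in 𝓝 (fromRows S P), IsTLSSolution N.toRows₁ N.toRows₂ (φ N) ∧
        ∀ X, IsTLSSolution N.toRows₁ N.toRows₂ X → X = φ N) ∧
      ∀ Δ, rdiag s * (Vs.toRows₁ᴴ * φ' Δ * V₂.toRows₂) = Usᴴ * (Δ.toRows₁ * V₂) ∧
        rdiag σ₁ * (rdiag σ₁ * (V₁.toRows₁ᴴ * φ' Δ * V₂.toRows₂)) -
          V₁.toRows₁ᴴ * φ' Δ * V₂.toRows₂ * (rdiag σ₂ * rdiag σ₂) =
        V₁ᴴ * ((Δ.toRows₂ᴴ - Δ.toRows₁ᴴ * (P * Sd)ᴴ) * (U₂ * rdiag σ₂)) +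
          rdiag σ₁ * (U₁ᴴ * (Δ.toRows₂ * V₂) -
            U₁ᴴ * (P * Sd) * Us * (Usᴴ * (Δ.toRows₁ * V₂))) := by
  set w : Matrix (α ⊕ β) (ν ⊕ δ) ℂ × Matrix ν δ ℂ × Matrix α δ ℂ × Matrix δ δ ℂ :=
    (fromRows S P, sol V₂, -(Sdᴴ * (Pᴴ * (U₂ * rdiag σ₂))) * V₂.toRows₂⁻¹,
      V₂.toRows₂ * (rdiag σ₂ * rdiag σ₂) * V₂.toRows₂⁻¹) with hw
  have hw0 : stationarity w = 0 := by
    simp only [stationarity, hw, toRows₁_fromRows, toRows₂_fromRows, h.s_augment_sol,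
      h.gram_augment_sol, sub_self]
    rfl
  obtain ⟨L, hL, hLv⟩ := hasStrictFDerivAt_stationarity w
  simp only [hw, toRows₁_fromRows, toRows₂_fromRows] at hLv
  have hinj : ∀ u, L (0, u) = 0 → u = 0 := by
    rintro ⟨dX, dΛ, dM⟩ h0
    rw [hLv] at h0
    have h1 := congrArg Prod.fst h0
    have h2 := congrArg Prod.snd h0
    have z1 : (0 : Matrix (α ⊕ β) (ν ⊕ δ) ℂ).toRows₁ = 0 := rfl
    have z2 : (0 : Matrix (α ⊕ β) (ν ⊕ δ) ℂ).toRows₂ = 0 := rfl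
    simp only [z1, z2, Matrix.zero_mul, conjTranspose_zero, add_zero, Prod.fst_zero,
      Prod.snd_zero] at h1 h2
    obtain ⟨rfl, rfl, rfl⟩ := h.linearized_injective h1 h2
    rfl
  -- The multiplier `M` supplies the `δ × δ` unknowns that match the lower block of the second
  -- equation.
  have hdim : Module.finrank ℝ (Matrix ν δ ℂ × Matrix α δ ℂ × Matrix δ δ ℂ) =
      Module.finrank ℝ (Matrix α δ ℂ × Matrix (ν ⊕ δ) δ ℂ) := by
    simp only [Module.finrank_prod, Module.finrank_matrix, Fintype.card_sum]
    ring
  obtain ⟨ψ, ψ', hψd, hψt, hψ0, hLψ⟩ := exists_implicit_solution hL hinj hdim hw0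
  obtain ⟨c, c', hc, hle, hge⟩ := h.exists_gap
  have htX : Tendsto (fun N => augment (ψ N).1) (𝓝 (fromRows S P)) (𝓝 (augment (sol V₂))) :=
    (continuous_augment.tendsto _).comp ((continuous_fst.tendsto _).comp hψt)
  have htP : Tendsto (fun N : Matrix (α ⊕ β) (ν ⊕ δ) ℂ => N.toRows₂) (𝓝 (fromRows S P)) (𝓝 P) :=
    (by fun_prop : Continuous fun N : Matrix (α ⊕ β) (ν ⊕ δ) ℂ =>
      N.submatrix Sum.inr id).tendsto (fromRows S P)
  have htS : Tendsto (fun N : Matrix (α ⊕ β) (ν ⊕ δ) ℂ => N.toRows₁) (𝓝 (fromRows S P)) (𝓝 S) :=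
    (by fun_prop : Continuous fun N : Matrix (α ⊕ β) (ν ⊕ δ) ℂ =>
      N.submatrix Sum.inl id).tendsto (fromRows S P)
  refine ⟨fun N => (ψ N).1, (ContinuousLinearMap.fst ℝ _ _).comp ψ', hψd.fst, ?_,
    fun Δ => ?_⟩
  · filter_upwards [hψ0, (htP.prodMk_nhds htX).eventually (eventually_upper_gap hle),
      (htS.prodMk_nhds (htP.prodMk_nhds htX)).eventually (eventually_lower_gap hge)]
      with N h0 h1 h2
    exact existsUnique_isTLSSolution hc (congrArg Prod.fst h0)
      (sub_eq_zero.1 (congrArg Prod.snd h0)) h1 h2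
  · have h0 := (hLv (Δ, ψ' Δ)).symm.trans (hLψ Δ)
    exact h.linearized (dΛ := (ψ' Δ).2.1) (dM := (ψ' Δ).2.2) (congrArg Prod.fst h0)
      (congrArg Prod.snd h0)

end

end SpectralData

end SolutionMap

/-! ### The matrix formula for the derivative -/

section Formula

variable {m n d p q : ℕ}

theorem permPi_apply {α β : Type*} [Fintype α] [DecidableEq α] [Fintype β] [DecidableEq β]
    (x : α × β) (y : β × α) : permPi α β x y = if x = y.swap then 1 else 0 := by
  rcases x with ⟨a, b⟩
  rcases y with ⟨b', a'⟩
  simp only [permPi, Matrix.sum_apply, kroneckerMap_apply, transpose_apply, single_apply,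
    Prod.swap_prod_mk, Prod.mk.injEq]
  rw [Finset.sum_eq_single a (fun i _ hi => by simp [hi]) (by simp),
    Finset.sum_eq_single b' (fun j _ hj => by simp [hj]) (by simp)]
  simp only [and_true, if_true, one_mul]
  congr 1
  simp only [eq_iff_iff]
  tauto

theorem permPi_mulVec {α β : Type*} [Fintype α] [DecidableEq α] [Fintype β] [DecidableEq β]
    (v : β × α → ℂ) : permPi α β *ᵥ v = v ∘ Prod.swap := by
  funext x
  simp only [mulVec, dotProduct, permPi_apply, ite_mul, one_mul, zero_mul, Function.comp_apply]
  rw [Finset.sum_eq_single x.swap] <;> aesop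

/-- `H_c` maps the vectorization of `ζ` to that of `W₁⁻ᴴ ζ V₂₂⁻¹`. -/
theorem Hc_mulVec (h : n = 2 * p + q) (V22 : Matrix (Fin d) (Fin d) ℂ)
    (W₁ : Matrix (Fin n) (Idx p q) ℂ) (ζ : Matrix (Idx p q) (Fin d) ℂ) (x : Fin d × Fin n) :
    (Hc h V22 W₁ *ᵥ fun y => ζ y.1 y.2) x =
      ((sqInv (idxEquiv h) W₁)ᴴ * ζ * V22⁻¹) x.2 x.1 := by
  rw [Hc, ← mulVec_mulVec, permPi_mulVec]
  simp only [mulVec, dotProduct, Fintype.sum_prod_type, kroneckerMap_apply, mul_apply,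
    transpose_apply, Function.comp_apply, Prod.swap, Finset.sum_mul]
  refine Finset.sum_congr rfl fun j _ => Finset.sum_congr rfl fun i _ => ?_
  ring

theorem sqInv_conjTranspose_of_leftInv {α β : Type*} [Fintype α] [DecidableEq α] [Fintype β]
    [DecidableEq β] (e : β ≃ α) {M : Matrix α β ℂ} {K : Matrix α β ℂ} (h : K * Mᴴ = 1) :
    (sqInv e M)ᴴ = K := by
  have h1 : M * Kᴴ = 1 := by simpa using congrArg conjTranspose h
  have h2 : M.submatrix id e.symm * Kᴴ.submatrix e.symm id = 1 := by
    rw [submatrix_mul_equiv M Kᴴ id e.symm id, h1, submatrix_id_id]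
  rw [sqInv, inv_eq_right_inv h2]
  ext i j
  simp

/-- The coefficient matrix of the equation for `ζ` is diagonal. -/
theorem coeff_eq_diagonal (s : Fin p ⊕ Fin p → ℝ) (σ₁ : Fin q → ℝ) (σ₂ : Fin d → ℝ) :
    ((Sc s σ₁) ^ 2) ⊗ₖ (1 : Matrix (Fin d) (Fin d) ℂ) -
        tailProj p q ⊗ₖ ((rdiag σ₂)ᴴ * rdiag σ₂) =
      diagonal fun x : Idx p q × Fin d =>
        (Sum.elim (fun i => (s i : ℂ) ^ 2) (fun i => (σ₁ i : ℂ) ^ 2 - (σ₂ x.2 : ℂ) ^ 2) x.1) := by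
  have h1 : Sc s σ₁ = diagonal (Sum.elim (fun i => (s i : ℂ)) fun i => (σ₁ i : ℂ)) := by
    rw [Sc, rdiag, rdiag, fromBlocks_diagonal]
  have h2 : tailProj p q = diagonal (Sum.elim (fun _ => 0) fun _ => 1) := by
    rw [tailProj, ← diagonal_one, ← diagonal_zero, fromBlocks_diagonal]
  rw [h1, h2, diagonal_pow, rdiag_conjTranspose, rdiag, diagonal_mul_diagonal, ← diagonal_one,
    diagonal_kronecker_diagonal, diagonal_kronecker_diagonal, diagonal_sub]
  congr 1
  funext ⟨x, j⟩
  rcases x with x | x <;> simp [sq]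

variable {S : Matrix (Fin p ⊕ Fin p) (Fin n ⊕ Fin d) ℂ}
    {P : Matrix (Fin m ⊕ Fin m) (Fin n ⊕ Fin d) ℂ}
    {Us : Matrix (Fin p ⊕ Fin p) (Fin p ⊕ Fin p) ℂ} {s : Fin p ⊕ Fin p → ℝ}
    {Vs : Matrix (Fin n ⊕ Fin d) (Fin p ⊕ Fin p) ℂ}
    {U₁ : Matrix (Fin m ⊕ Fin m) (Fin q) ℂ} {σ₁ : Fin q → ℝ}
    {V₁ : Matrix (Fin n ⊕ Fin d) (Fin q) ℂ}
    {U₂ : Matrix (Fin m ⊕ Fin m) (Fin d) ℂ} {σ₂ : Fin d → ℝ}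
    {V₂ : Matrix (Fin n ⊕ Fin d) (Fin d) ℂ}
    {Sd : Matrix (Fin n ⊕ Fin d) (Fin p ⊕ Fin p) ℂ}

/-- The vector to which the matrix `H_c G_c Z_c` is applied, for a perturbation `Δ` of `[S; P]`. -/
def inputVec (W : Matrix (Fin n ⊕ Fin d) (Idx p q) ℂ) (V₂ : Matrix (Fin n ⊕ Fin d) (Fin d) ℂ)
    (Us : Matrix (Fin p ⊕ Fin p) (Fin p ⊕ Fin p) ℂ) (U₁ : Matrix (Fin m ⊕ Fin m) (Fin q) ℂ)
    (Δ : Matrix ((Fin p ⊕ Fin p) ⊕ (Fin m ⊕ Fin m)) (Fin n ⊕ Fin d) ℂ) :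
    (Idx p q × ((Fin p ⊕ Fin p) ⊕ (Fin m ⊕ Fin m))) ⊕ (Idx p q × Fin d) → ℂ :=
  Sum.elim (fun x => (Δ * W)ᴴ x.1 x.2)
    (fun x => ((fromBlocks Us 0 0 U₁ :
      Matrix ((Fin p ⊕ Fin p) ⊕ (Fin m ⊕ Fin m)) (Idx p q) ℂ)ᴴ * (Δ * V₂)) x.1 x.2)

/-- Matrices are vectorized by (row, column) pairs, so the second Kronecker factor acts through its
plain transpose. -/
theorem kronecker_mulVec_apply {α β γ κ : Type*} [Fintype α] [Fintype β] [Fintype γ] [Fintype κ]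
    (M : Matrix α β ℂ) (N : Matrix γ κ ℂ) (Z : Matrix β κ ℂ) (x : α × γ) :
    ((M ⊗ₖ N) *ᵥ fun y => Z y.1 y.2) x = (M * Z * Nᵀ) x.1 x.2 := by
  simp only [mulVec, dotProduct, Fintype.sum_prod_type, kroneckerMap_apply, mul_apply,
    transpose_apply, Finset.sum_mul]
  rw [Finset.sum_comm]
  refine Finset.sum_congr rfl fun j _ => Finset.sum_congr rfl fun i _ => ?_
  ring

namespace SpectralData

variable (h : SpectralData S P Us s Vs U₁ σ₁ V₁ U₂ σ₂ V₂ Sd)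
include h

/-- `Z_c` assembles the right-hand sides of the linearized equations, the other factor of `G_c`
weights them by `Σ₂` and `S_c`, and its inverse factor is diagonal, with nonzero entries because of
the gap. -/
theorem gc_zc_mulVec {Δ : Matrix ((Fin p ⊕ Fin p) ⊕ (Fin m ⊕ Fin m)) (Fin n ⊕ Fin d) ℂ}
    {ζs : Matrix (Fin p ⊕ Fin p) (Fin d) ℂ} {ζ₁ : Matrix (Fin q) (Fin d) ℂ}
    (e₁ : rdiag s * ζs = Usᴴ * (Δ.toRows₁ * V₂))
    (e₂ : rdiag σ₁ * (rdiag σ₁ * ζ₁) - ζ₁ * (rdiag σ₂ * rdiag σ₂) =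
        V₁ᴴ * ((Δ.toRows₂ᴴ - Δ.toRows₁ᴴ * (P * Sd)ᴴ) * (U₂ * rdiag σ₂)) +
          rdiag σ₁ * (U₁ᴴ * (Δ.toRows₂ * V₂) -
            U₁ᴴ * (P * Sd) * Us * (Usᴴ * (Δ.toRows₁ * V₂)))) :
    (Gc (Sc s σ₁) (rdiag σ₂) * Zc (P * Sd) Us U₁ U₂) *ᵥ
      inputVec (fromCols Vs V₁) V₂ Us U₁ Δ = fun y => fromRows ζs ζ₁ y.1 y.2 := by
  have hdet : IsUnit (diagonal fun x : Idx p q × Fin d =>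
      (Sum.elim (fun i => (s i : ℂ) ^ 2) (fun i => (σ₁ i : ℂ) ^ 2 - (σ₂ x.2 : ℂ) ^ 2) x.1)).det := by
    rw [det_diagonal, isUnit_iff_ne_zero, Finset.prod_ne_zero_iff]
    rintro ⟨x | x, j⟩ -
    · exact pow_ne_zero _ (by exact_mod_cast (h.s_pos x).ne')
    · exact h.mul_sq_sub_ne x j
  have hblock : (fromBlocks Us 0 0 U₁ :
      Matrix ((Fin p ⊕ Fin p) ⊕ (Fin m ⊕ Fin m)) (Idx p q) ℂ)ᴴ * (Δ * V₂) =
      fromRows (Usᴴ * (Δ.toRows₁ * V₂)) (U₁ᴴ * (Δ.toRows₂ * V₂)) := by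
    conv_lhs => rw [← fromRows_toRows Δ]
    rw [fromBlocks_conjTranspose, fromRows_mul, fromBlocks_mul_fromRows]
    simp
  have hZ₁ : ∀ x, ((tailProj p q ⊗ₖ (U₂ᵀ * (Qc (P * Sd))ᵀ)) *ᵥ
      fun x => (Δ * fromCols Vs V₁)ᴴ x.1 x.2) x =
      fromRows (0 : Matrix (Fin p ⊕ Fin p) (Fin d) ℂ)
        (V₁ᴴ * ((Δ.toRows₂ᴴ - Δ.toRows₁ᴴ * (P * Sd)ᴴ) * U₂)) x.1 x.2 := by
    intro x
    rw [kronecker_mulVec_apply]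
    rw [transpose_mul, transpose_transpose, transpose_transpose, conjTranspose_mul,
      conjTranspose_fromCols_eq_fromRows_conjTranspose, tailProj, fromRows_mul,
      fromBlocks_mul_fromRows, Matrix.zero_mul, Matrix.zero_mul, Matrix.zero_mul, Matrix.one_mul,
      zero_add, zero_add, fromRows_mul, Matrix.zero_mul, Qc]
    conv_lhs => rw [← fromRows_toRows Δ]
    rw [conjTranspose_fromRows_eq_fromCols_conjTranspose, Matrix.mul_assoc, ← Matrix.mul_assoc _ _ U₂,
      fromCols_mul_fromRows, Matrix.mul_neg, Matrix.mul_one, neg_add_eq_sub]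
  have hZ₂ : ∀ x, (((fromBlocks 1 0 (-(U₁ᴴ * (P * Sd) * Us)) 1 : Matrix (Idx p q) (Idx p q) ℂ) ⊗ₖ
        (1 : Matrix (Fin d) (Fin d) ℂ)) *ᵥ fun x => ((fromBlocks Us 0 0 U₁ :
      Matrix ((Fin p ⊕ Fin p) ⊕ (Fin m ⊕ Fin m)) (Idx p q) ℂ)ᴴ * (Δ * V₂)) x.1 x.2) x =
      fromRows (Usᴴ * (Δ.toRows₁ * V₂)) (U₁ᴴ * (Δ.toRows₂ * V₂) -
            U₁ᴴ * (P * Sd) * Us * (Usᴴ * (Δ.toRows₁ * V₂))) x.1 x.2 := by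
    intro x
    rw [kronecker_mulVec_apply, hblock, fromBlocks_mul_fromRows, transpose_one, Matrix.mul_one,
      Matrix.one_mul, Matrix.zero_mul, add_zero, Matrix.one_mul, Matrix.neg_mul, neg_add_eq_sub]
  have hzc : Zc (P * Sd) Us U₁ U₂ *ᵥ inputVec (fromCols Vs V₁) V₂ Us U₁ Δ =
      Sum.elim (fun x => fromRows (0 : Matrix (Fin p ⊕ Fin p) (Fin d) ℂ)
        (V₁ᴴ * ((Δ.toRows₂ᴴ - Δ.toRows₁ᴴ * (P * Sd)ᴴ) * U₂)) x.1 x.2)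
        (fun x => fromRows (Usᴴ * (Δ.toRows₁ * V₂)) (U₁ᴴ * (Δ.toRows₂ * V₂) -
            U₁ᴴ * (P * Sd) * Us * (Usᴴ * (Δ.toRows₁ * V₂))) x.1 x.2) := by
    rw [Zc, inputVec, fromBlocks_mulVec]
    simp only [Sum.elim_comp_inl, Sum.elim_comp_inr, zero_mulVec, add_zero, zero_add]
    rw [funext hZ₁, funext hZ₂]
  rw [← mulVec_mulVec, hzc, Gc, ← mulVec_mulVec, coeff_eq_diagonal]
  have hfin : (fromCols ((1 : Matrix (Idx p q) (Idx p q) ℂ) ⊗ₖ (rdiag σ₂)ᴴ)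
      (Sc s σ₁ ⊗ₖ (1 : Matrix (Fin d) (Fin d) ℂ))) *ᵥ
      Sum.elim (fun x => fromRows (0 : Matrix (Fin p ⊕ Fin p) (Fin d) ℂ)
        (V₁ᴴ * ((Δ.toRows₂ᴴ - Δ.toRows₁ᴴ * (P * Sd)ᴴ) * U₂)) x.1 x.2)
        (fun x => fromRows (Usᴴ * (Δ.toRows₁ * V₂)) (U₁ᴴ * (Δ.toRows₂ * V₂) -
            U₁ᴴ * (P * Sd) * Us * (Usᴴ * (Δ.toRows₁ * V₂))) x.1 x.2) =
      (diagonal fun x : Idx p q × Fin d =>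
        (Sum.elim (fun i => (s i : ℂ) ^ 2) (fun i => (σ₁ i : ℂ) ^ 2 - (σ₂ x.2 : ℂ) ^ 2) x.1)) *ᵥ
        fun y => fromRows ζs ζ₁ y.1 y.2 := by
    rw [fromCols_mulVec_sumElim]
    funext ⟨x, j⟩
    rw [Pi.add_apply, kronecker_mulVec_apply, kronecker_mulVec_apply, mulVec_diagonal,
      rdiag_conjTranspose, Sc, transpose_one, Matrix.mul_one, Matrix.one_mul,
      fromBlocks_mul_fromRows, fromRows_mul, Matrix.zero_mul, Matrix.zero_mul, Matrix.zero_mul]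
    have ht : (rdiag σ₂)ᵀ = rdiag σ₂ := by simp [rdiag]
    rw [ht, ← e₁]
    -- In the constraint rows the equation `s ζ = …` is multiplied by `s` once more, which gives the
    -- coefficient `s²` of `G_c`.
    rcases x with x | x
    · simp only [fromRows_apply_inl, Matrix.zero_apply, zero_add, add_zero, Sum.elim_inl]
      rw [rdiag_mul_apply, rdiag_mul_apply]
      ring
    · have := congrFun (congrFun e₂ x) j
      rw [← e₁, Matrix.sub_apply, rdiag_mul_apply, rdiag_mul_apply, ← Matrix.mul_assoc ζ₁,
        mul_rdiag_apply, mul_rdiag_apply] at this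
      simp only [fromRows_apply_inr, zero_add, Sum.elim_inr]
      rw [← Matrix.add_apply, Matrix.mul_assoc, Matrix.mul_assoc _ U₂, ← this]
      ring
  rw [hfin, mulVec_mulVec, nonsing_inv_mul _ hdet, one_mulVec]

end SpectralData

end Formula

/-! ### Operator norms -/

section SpecNorm

open scoped Matrix.Norms.L2Operator

variable {α β : Type*} [Fintype α] [Fintype β] [DecidableEq β]

theorem norm_mulVec_le_specNorm (M : Matrix α β ℂ) (v : β → ℂ) :
    ‖WithLp.toLp 2 (M *ᵥ v)‖ ≤ specNorm M * ‖WithLp.toLp 2 v‖ :=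
  l2_opNorm_mulVec M (WithLp.toLp 2 v)

theorem specNorm_le {M : Matrix α β ℂ} {c : ℝ} (hc : 0 ≤ c)
    (h : ∀ v : β → ℂ, ‖WithLp.toLp 2 (M *ᵥ v)‖ ≤ c * ‖WithLp.toLp 2 v‖) : specNorm M ≤ c := by
  rw [specNorm, l2_opNorm_def]
  exact ContinuousLinearMap.opNorm_le_bound _ hc fun v => h v.ofLp

theorem specNorm_nonneg (M : Matrix α β ℂ) : 0 ≤ specNorm M := norm_nonneg M

end SpecNorm

/-! ### The operator norm of the derivative -/

section InputVec

open scoped Matrix.Norms.Frobenius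

variable {m n d p q : ℕ}

theorem norm_toLp_prod_sq {α β : Type*} [Fintype α] [Fintype β] (A : Matrix α β ℂ) :
    ∑ x : α × β, ‖A x.1 x.2‖ ^ 2 = ‖A‖ ^ 2 := by
  rw [frob_sq_eq_sum, Fintype.sum_prod_type]

theorem norm_inputVec_sq (W : Matrix (Fin n ⊕ Fin d) (Idx p q) ℂ)
    (V₂ : Matrix (Fin n ⊕ Fin d) (Fin d) ℂ)
    (Us : Matrix (Fin p ⊕ Fin p) (Fin p ⊕ Fin p) ℂ) (U₁ : Matrix (Fin m ⊕ Fin m) (Fin q) ℂ)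
    (Δ : Matrix ((Fin p ⊕ Fin p) ⊕ (Fin m ⊕ Fin m)) (Fin n ⊕ Fin d) ℂ) :
    ‖WithLp.toLp 2 (inputVec W V₂ Us U₁ Δ)‖ ^ 2 = ‖Δ * W‖ ^ 2 +
      ‖(fromBlocks Us 0 0 U₁ :
        Matrix ((Fin p ⊕ Fin p) ⊕ (Fin m ⊕ Fin m)) (Idx p q) ℂ)ᴴ * (Δ * V₂)‖ ^ 2 := by
  rw [EuclideanSpace.norm_sq_eq, Fintype.sum_sum_type]
  simp only [inputVec, Sum.elim_inl, Sum.elim_inr]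
  rw [norm_toLp_prod_sq, norm_toLp_prod_sq, frobenius_norm_conjTranspose]

variable {S : Matrix (Fin p ⊕ Fin p) (Fin n ⊕ Fin d) ℂ}
    {P : Matrix (Fin m ⊕ Fin m) (Fin n ⊕ Fin d) ℂ}
    {Us : Matrix (Fin p ⊕ Fin p) (Fin p ⊕ Fin p) ℂ} {s : Fin p ⊕ Fin p → ℝ}
    {Vs : Matrix (Fin n ⊕ Fin d) (Fin p ⊕ Fin p) ℂ}
    {U₁ : Matrix (Fin m ⊕ Fin m) (Fin q) ℂ} {σ₁ : Fin q → ℝ}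
    {V₁ : Matrix (Fin n ⊕ Fin d) (Fin q) ℂ}
    {U₂ : Matrix (Fin m ⊕ Fin m) (Fin d) ℂ} {σ₂ : Fin d → ℝ}
    {V₂ : Matrix (Fin n ⊕ Fin d) (Fin d) ℂ}
    {Sd : Matrix (Fin n ⊕ Fin d) (Fin p ⊕ Fin p) ℂ}

namespace SpectralData

variable (h : SpectralData S P Us s Vs U₁ σ₁ V₁ U₂ σ₂ V₂ Sd)
include h

theorem block_orthonormal : (fromBlocks Us 0 0 U₁ :
    Matrix ((Fin p ⊕ Fin p) ⊕ (Fin m ⊕ Fin m)) (Idx p q) ℂ)ᴴ * fromBlocks Us 0 0 U₁ = 1 := by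
  rw [fromBlocks_conjTranspose, fromBlocks_multiply, ← fromBlocks_one]
  simp [h.us_left, h.u₁_u₁]

theorem w_w : (fromCols Vs V₁)ᴴ * fromCols Vs V₁ = 1 := by
  have h1 : V₁ᴴ * Vs = 0 := by simpa using congrArg conjTranspose h.vs_v₁
  rw [conjTranspose_fromCols_eq_fromRows_conjTranspose, fromRows_mul_fromCols, h.vs_vs, h.vs_v₁,
    h.v₁_v₁, h1, fromBlocks_one]

theorem w_v₂ : (fromCols Vs V₁)ᴴ * V₂ = 0 := by
  rw [conjTranspose_fromCols_eq_fromRows_conjTranspose, fromRows_mul, h.vs_v₂, h.v₁_v₂,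
    fromRows_zero]

theorem norm_sq_decomp (Δ : Matrix ((Fin p ⊕ Fin p) ⊕ (Fin m ⊕ Fin m)) (Fin n ⊕ Fin d) ℂ) :
    ‖Δ‖ ^ 2 = ‖Δ * fromCols Vs V₁‖ ^ 2 + ‖Δ * V₂‖ ^ 2 := by
  have h1 : Δ = Δ * fromCols Vs V₁ * (fromCols Vs V₁)ᴴ + Δ * V₂ * V₂ᴴ := by
    rw [Matrix.mul_assoc, Matrix.mul_assoc, ← Matrix.mul_add,
      conjTranspose_fromCols_eq_fromRows_conjTranspose, fromCols_mul_fromRows, h.complete,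
      Matrix.mul_one]
  conv_lhs => rw [h1]
  rw [frob_sq_add', frob_mul_conjTranspose_of_orthonormal h.w_w,
    frob_mul_conjTranspose_of_orthonormal h.v₂_v₂]
  rw [conjTranspose_mul, conjTranspose_conjTranspose, Matrix.mul_assoc, ← Matrix.mul_assoc _ V₂,
    h.w_v₂, Matrix.zero_mul, Matrix.mul_zero]

/-- Only `Δ V₂` can lose length: it is seen through the orthonormal columns of `diag(Us, U₁)`, which
need not span the whole space. -/
theorem norm_inputVec_le (Δ : Matrix ((Fin p ⊕ Fin p) ⊕ (Fin m ⊕ Fin m)) (Fin n ⊕ Fin d) ℂ) :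
    ‖WithLp.toLp 2 (inputVec (fromCols Vs V₁) V₂ Us U₁ Δ)‖ ≤ ‖Δ‖ := by
  refine le_of_sq_le_sq ?_ (norm_nonneg _)
  rw [norm_inputVec_sq, h.norm_sq_decomp]
  gcongr
  exact frob_conjTranspose_mul_le_of_orthonormal h.block_orthonormal _

/-- The preimage is `aᴴ Wᴴ + Ω b V₂ᴴ`, where `a` and `b` are the two parts of `x`. With the previous
bound, the real-linear input map sends the unit ball onto the whole complex unit ball. -/
theorem exists_inputVec_eq
    (x : (Idx p q × ((Fin p ⊕ Fin p) ⊕ (Fin m ⊕ Fin m))) ⊕ (Idx p q × Fin d) → ℂ) :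
    ∃ Δ, inputVec (fromCols Vs V₁) V₂ Us U₁ Δ = x ∧ ‖Δ‖ = ‖WithLp.toLp 2 x‖ := by
  set Ω : Matrix ((Fin p ⊕ Fin p) ⊕ (Fin m ⊕ Fin m)) (Idx p q) ℂ := fromBlocks Us 0 0 U₁ with hΩ
  have hΩo : Ωᴴ * Ω = 1 := h.block_orthonormal
  set a : Matrix (Idx p q) ((Fin p ⊕ Fin p) ⊕ (Fin m ⊕ Fin m)) ℂ := of fun i k => x (.inl (i, k))
    with ha
  set b : Matrix (Idx p q) (Fin d) ℂ := of fun i k => x (.inr (i, k)) with hb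
  set Δ := aᴴ * (fromCols Vs V₁)ᴴ + Ω * b * V₂ᴴ with hΔ
  have hv₂w : V₂ᴴ * fromCols Vs V₁ = 0 := by simpa using congrArg conjTranspose h.w_v₂
  have h1 : Δ * fromCols Vs V₁ = aᴴ := by
    rw [hΔ, Matrix.add_mul, Matrix.mul_assoc, h.w_w, Matrix.mul_assoc (Ω * b), hv₂w]
    simp
  have h2 : Δ * V₂ = Ω * b := by
    rw [hΔ, Matrix.add_mul, Matrix.mul_assoc, h.w_v₂, Matrix.mul_assoc (Ω * b), h.v₂_v₂]
    simp
  have hx : inputVec (fromCols Vs V₁) V₂ Us U₁ Δ = x := by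
    rw [inputVec, ← hΩ, h1, h2, ← Matrix.mul_assoc, hΩo, Matrix.one_mul, conjTranspose_conjTranspose]
    funext i
    rcases i with i | i <;> rfl
  refine ⟨Δ, hx, ?_⟩
  rw [← sq_eq_sq₀ (norm_nonneg _) (norm_nonneg _)]
  conv_rhs => rw [← hx]
  rw [norm_inputVec_sq, h.norm_sq_decomp, h2, ← hΩ, ← Matrix.mul_assoc, hΩo, Matrix.one_mul,
    frob_mul_of_orthonormal hΩo]

/-- The spectral norm of `H_c G_c Z_c` is the operator norm of the derivative of the solution
map. -/
theorem specNorm_isLeast (hn : n = 2 * p + q)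
    (φ' : Matrix ((Fin p ⊕ Fin p) ⊕ (Fin m ⊕ Fin m)) (Fin n ⊕ Fin d) ℂ →
      Matrix (Fin n) (Fin d) ℂ)
    (hφ : ∀ Δ, rdiag s * (Vs.toRows₁ᴴ * φ' Δ * V₂.toRows₂) = Usᴴ * (Δ.toRows₁ * V₂) ∧
        rdiag σ₁ * (rdiag σ₁ * (V₁.toRows₁ᴴ * φ' Δ * V₂.toRows₂)) -
          V₁.toRows₁ᴴ * φ' Δ * V₂.toRows₂ * (rdiag σ₂ * rdiag σ₂) =
        V₁ᴴ * ((Δ.toRows₂ᴴ - Δ.toRows₁ᴴ * (P * Sd)ᴴ) * (U₂ * rdiag σ₂)) +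
          rdiag σ₁ * (U₁ᴴ * (Δ.toRows₂ * V₂) -
            U₁ᴴ * (P * Sd) * Us * (Usᴴ * (Δ.toRows₁ * V₂)))) :
    IsLeast {c : ℝ | 0 ≤ c ∧ ∀ Δ, ‖φ' Δ‖ ≤ c * ‖Δ‖}
      (specNorm (Hc hn V₂.toRows₂ (W1c Vs V₁) * Gc (Sc s σ₁) (rdiag σ₂) *
        Zc (P * Sd) Us U₁ U₂)) := by
  set K := Hc hn V₂.toRows₂ (W1c Vs V₁) * Gc (Sc s σ₁) (rdiag σ₂) * Zc (P * Sd) Us U₁ U₂ with hK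
  have hval : ∀ Δ, K *ᵥ inputVec (fromCols Vs V₁) V₂ Us U₁ Δ = fun x => (φ' Δ)ᵀ x.1 x.2 := by
    intro Δ
    rw [hK, Matrix.mul_assoc, ← mulVec_mulVec, h.gc_zc_mulVec (hφ Δ).1 (hφ Δ).2]
    funext x
    rw [Hc_mulVec, W1c, sqInv_conjTranspose_of_leftInv _ h.leftInv_w₁, ← h.eq_of_coordinates,
      transpose_apply]
  have hnorm : ∀ Δ, ‖WithLp.toLp 2 (K *ᵥ inputVec (fromCols Vs V₁) V₂ Us U₁ Δ)‖ = ‖φ' Δ‖ := by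
    intro Δ
    rw [← sq_eq_sq₀ (norm_nonneg _) (norm_nonneg _), hval, EuclideanSpace.norm_sq_eq,
      ← frobenius_norm_transpose (φ' Δ), ← norm_toLp_prod_sq]
  refine ⟨⟨specNorm_nonneg K, fun Δ => ?_⟩, fun c hc => specNorm_le hc.1 fun v => ?_⟩
  · rw [← hnorm]
    exact (norm_mulVec_le_specNorm K _).trans
      (mul_le_mul_of_nonneg_left (h.norm_inputVec_le Δ) (specNorm_nonneg K))
  · obtain ⟨Δ, rfl, hΔ⟩ := h.exists_inputVec_eq v
    rw [hnorm, ← hΔ]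
    exact hc.2 Δ

end SpectralData

end InputVec

/-! ### Relative condition numbers of differentiable maps -/

section Condition

variable {E F : Type*} [NormedAddCommGroup E] [NormedSpace ℝ E] [NormedAddCommGroup F]
  [NormedSpace ℝ F]

/-- The lower bound follows rays in directions where `L` is nearly maximal; the upper bound uses
that the remainder is `o(‖Δ‖)` uniformly in the direction. -/
theorem tendsto_sSup_relChange {φ : E → F} {L : E →L[ℝ] F} {a : E} (hφ : HasFDerivAt φ L a)
    {κ ρ c : ℝ} (hκ : IsLeast {c : ℝ | 0 ≤ c ∧ ∀ v, ‖L v‖ ≤ c * ‖v‖} κ) (hρ : 0 ≤ ρ)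
    (hc : 0 < c) :
    Tendsto (fun ε : ℝ => sSup {r : ℝ≥0∞ | ∃ Δ : E, ‖Δ‖ ≤ ε * ρ ∧
      r = ENNReal.ofReal (‖φ (a + Δ) - φ a‖ / (ε * c))}) (𝓝[>] 0)
      (𝓝 (ENNReal.ofReal (κ * (ρ / c)))) := by
  obtain rfl : ‖L‖ = κ := le_antisymm (L.opNorm_le_bound hκ.1.1 hκ.1.2)
    (hκ.2 ⟨norm_nonneg L, L.le_opNorm⟩)
  refine tendsto_order.2 ⟨fun b hb => ?_, fun b hb => ?_⟩
  · have hbt : b ≠ ⊤ := (hb.trans ENNReal.ofReal_lt_top).ne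
    have hb' : b.toReal < ‖L‖ * (ρ / c) := (ENNReal.lt_ofReal_iff_toReal_lt hbt).1 hb
    obtain ⟨v, hv, hbv⟩ : ∃ v : E, ‖v‖ ≤ 1 ∧ b.toReal < ‖L v‖ * (ρ / c) := by
      by_contra! hcon
      -- If `ρ = 0` the limit is `0`, and nothing in `[0, ∞]` lies below it.
      have hρ' : 0 < ρ / c := by
        refine lt_of_le_of_ne (by positivity) fun h0 => ?_
        rw [← h0, mul_zero] at hb'
        exact absurd ENNReal.toReal_nonneg hb'.not_ge
      have : ‖L‖ ≤ b.toReal / (ρ / c) := by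
        refine L.opNorm_le_of_unit_norm (by positivity) fun x hx => ?_
        rw [le_div_iff₀ hρ']
        exact hcon x hx.le
      rw [le_div_iff₀ hρ'] at this
      exact absurd hb' this.not_gt
    have hlim : Tendsto (fun ε : ℝ => ENNReal.ofReal (‖φ (a + ε • (ρ • v)) - φ a‖ / (ε * c)))
        (𝓝[>] 0) (𝓝 (ENNReal.ofReal (‖L v‖ * (ρ / c)))) := by
      refine ENNReal.tendsto_ofReal ?_
      have h1 : HasDerivAt (fun ε : ℝ => φ (a + ε • (ρ • v))) (L (ρ • v)) 0 := by
        have h2 : HasDerivAt (fun ε : ℝ => a + ε • (ρ • v)) (ρ • v) 0 := by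
          simpa using ((hasDerivAt_id (0 : ℝ)).smul_const (ρ • v)).const_add a
        exact HasFDerivAt.comp_hasDerivAt (0 : ℝ) (by simpa using hφ) h2
      have h3 := h1.tendsto_slope_zero_right.norm.div_const c
      rw [map_smul, norm_smul, Real.norm_of_nonneg hρ,
        mul_comm ρ, mul_div_assoc] at h3
      refine h3.congr' ?_
      filter_upwards [self_mem_nhdsWithin] with ε hε
      rw [norm_smul, zero_add, zero_smul, add_zero, norm_inv,
          Real.norm_of_nonneg (le_of_lt hε)]
      field_simp
    filter_upwards [hlim.eventually_const_lt
      ((ENNReal.lt_ofReal_iff_toReal_lt hbt).2 hbv), self_mem_nhdsWithin] with ε hε hpos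
    refine hε.trans_le (le_sSup ⟨ε • (ρ • v), ?_, rfl⟩)
    rw [norm_smul, norm_smul, Real.norm_of_nonneg hρ, Real.norm_of_nonneg (le_of_lt hpos)]
    have : ε * (ρ * ‖v‖) ≤ ε * (ρ * 1) := by
      have := le_of_lt (Set.mem_Ioi.1 hpos)
      gcongr
    simpa using this
  · obtain ⟨η, hη, hηb⟩ : ∃ η : ℝ, 0 < η ∧ ENNReal.ofReal ((‖L‖ + η) * (ρ / c)) < b := by
      have hcont : Tendsto (fun η : ℝ => ENNReal.ofReal ((‖L‖ + η) * (ρ / c))) (𝓝[>] 0)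
          (𝓝 (ENNReal.ofReal (‖L‖ * (ρ / c)))) := by
        have : Continuous fun η : ℝ => ENNReal.ofReal ((‖L‖ + η) * (ρ / c)) :=
          ENNReal.continuous_ofReal.comp (by fun_prop)
        simpa using (this.tendsto 0).mono_left nhdsWithin_le_nhds
      obtain ⟨η, h1, h2⟩ := ((hcont.eventually_lt_const hb).and self_mem_nhdsWithin).exists
      exact ⟨η, h2, h1⟩
    have ho := (hasFDerivAt_iff_isLittleO_nhds_zero.1 hφ).def hη
    obtain ⟨δ, hδ, hball⟩ := Metric.eventually_nhds_iff.1 ho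
    have hε : ∀ᶠ ε : ℝ in 𝓝[>] 0, ε * ρ < δ := by
      have : Continuous fun ε : ℝ => ε * ρ := by fun_prop
      exact ((this.tendsto 0).mono_left nhdsWithin_le_nhds).eventually_lt_const (by simpa using hδ)
    filter_upwards [hε, self_mem_nhdsWithin] with ε hεδ hpos
    have hpos' : 0 < ε := hpos
    refine lt_of_le_of_lt (sSup_le ?_) hηb
    rintro _ ⟨Δ, hΔ, rfl⟩
    refine ENNReal.ofReal_le_ofReal ?_
    have h1 := hball (y := Δ) (by simpa using hΔ.trans_lt hεδ)
    have h2 : ‖φ (a + Δ) - φ a‖ ≤ (‖L‖ + η) * (ε * ρ) := by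
      calc ‖φ (a + Δ) - φ a‖ = ‖L Δ + (φ (a + Δ) - φ a - L Δ)‖ := by congr 1; abel
        _ ≤ ‖L‖ * ‖Δ‖ + η * ‖Δ‖ := (norm_add_le _ _).trans (add_le_add (L.le_opNorm Δ) h1)
        _ = (‖L‖ + η) * ‖Δ‖ := by ring
        _ ≤ _ := by gcongr
    rw [div_le_iff₀ (by positivity)]
    refine h2.trans (le_of_eq ?_)
    field_simp

end Condition

/-! ### Reduction to complex matrices -/

section Reduction

open scoped Matrix.Norms.Frobenius

theorem cCol_injective {α β : Type*} :
    Function.Injective (cCol : Matrix α β RB → Matrix (α ⊕ α) β ℂ) := fun M N h => by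
  ext i j
  · exact congrFun (congrFun h (.inl i)) j
  · exact congrFun (congrFun h (.inr i)) j

theorem cCol_add {α β : Type*} (M N : Matrix α β RB) : cCol (M + N) = cCol M + cCol N := by
  ext (i | i) j <;> rfl

/-- A complex factor has no `j` part, so it does not mix the two components. -/
theorem cCol_mul_ofComplex {α β γ : Type*} [Fintype β] (M : Matrix α β RB) (X : Matrix β γ ℂ) :
    cCol (M * ofComplex X) = cCol M * X := by
  have hre : ∀ (t : Finset β) (f : β → RB), (∑ k ∈ t, f k).re = ∑ k ∈ t, (f k).re := fun t f => by
    classical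
    induction t using Finset.induction_on with
    | empty => rfl
    | insert a t ha ih => rw [Finset.sum_insert ha, Finset.sum_insert ha, ← ih]; rfl
  have him : ∀ (t : Finset β) (f : β → RB), (∑ k ∈ t, f k).im = ∑ k ∈ t, (f k).im := fun t f => by
    classical
    induction t using Finset.induction_on with
    | empty => rfl
    | insert a t ha ih => rw [Finset.sum_insert ha, Finset.sum_insert ha, ← ih]; rfl
  ext (i | i) j
  · simp [cCol, mul_apply, hre, ofComplex]
  · simp [cCol, mul_apply, him, ofComplex]

theorem rbFrob_nonneg {α β : Type*} [Fintype α] [Fintype β] (M : Matrix α β RB) :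
    0 ≤ rbFrob M := Real.sqrt_nonneg _

theorem rbFrob_sq {α β : Type*} [Fintype α] [Fintype β] (M : Matrix α β RB) :
    rbFrob M ^ 2 = ‖cCol M‖ ^ 2 := by
  rw [rbFrob, Real.sq_sqrt (by positivity), frob_sq_eq_sum, Fintype.sum_sum_type,
    ← Finset.sum_add_distrib]
  refine Finset.sum_congr rfl fun i _ => ?_
  rw [← Finset.sum_add_distrib]
  rfl

variable {m n d p : ℕ}

theorem rbFrob_fromCols (G : Matrix (Fin m) (Fin n) RB) (H : Matrix (Fin m) (Fin d) RB) :
    rbFrob (fromCols G H) = ‖fromCols (cCol G) (cCol H)‖ := by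
  rw [← sq_eq_sq₀ (rbFrob_nonneg _) (norm_nonneg _), rbFrob_sq]
  congr 2
  ext (i | i) (j | j) <;> rfl

theorem rbFrob_dataJK (A : Matrix (Fin m) (Fin n) RB) (B : Matrix (Fin m) (Fin d) RB)
    (C : Matrix (Fin p) (Fin n) RB) (D : Matrix (Fin p) (Fin d) RB) :
    rbFrob (dataJK A B C D) = ‖dataJKc A B C D‖ := by
  rw [← sq_eq_sq₀ (rbFrob_nonneg _) (norm_nonneg _), rbFrob_sq, frob_sq_eq_sum, frob_sq_eq_sum]
  simp only [Fintype.sum_sum_type, cCol, dataJK, dataJKc, fromRows_apply_inl, fromRows_apply_inr,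
    fromCols_apply_inl, fromCols_apply_inr, map_apply]
  ring

theorem dataJKc_add (A ΔA : Matrix (Fin m) (Fin n) RB) (B ΔB : Matrix (Fin m) (Fin d) RB)
    (C ΔC : Matrix (Fin p) (Fin n) RB) (D ΔD : Matrix (Fin p) (Fin d) RB) :
    dataJKc (A + ΔA) (B + ΔB) (C + ΔC) (D + ΔD) = dataJKc A B C D + dataJKc ΔA ΔB ΔC ΔD := by
  ext ((i | i) | (i | i)) (j | j) <;> rfl

theorem exists_cCol_eq {α β : Type*} (M : Matrix (α ⊕ α) β ℂ) : ∃ N : Matrix α β RB, cCol N = M :=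
  ⟨of fun i j => ⟨M (.inl i) j, M (.inr i) j⟩, by ext (i | i) j <;> rfl⟩

theorem exists_dataJKc_eq
    (Δ : Matrix ((Fin p ⊕ Fin p) ⊕ (Fin m ⊕ Fin m)) (Fin n ⊕ Fin d) ℂ) :
    ∃ (A : Matrix (Fin m) (Fin n) RB) (B : Matrix (Fin m) (Fin d) RB)
      (C : Matrix (Fin p) (Fin n) RB) (D : Matrix (Fin p) (Fin d) RB), dataJKc A B C D = Δ := by
  obtain ⟨A, hA⟩ := exists_cCol_eq Δ.toBlocks₂₁
  obtain ⟨B, hB⟩ := exists_cCol_eq Δ.toBlocks₂₂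
  obtain ⟨C, hC⟩ := exists_cCol_eq Δ.toBlocks₁₁
  obtain ⟨D, hD⟩ := exists_cCol_eq Δ.toBlocks₁₂
  refine ⟨A, B, C, D, ?_⟩
  rw [dataJKc, hA, hB, hC, hD]
  ext (i | i) (j | j) <;> rfl

theorem dataJKc_eq_fromRows (A : Matrix (Fin m) (Fin n) RB) (B : Matrix (Fin m) (Fin d) RB)
    (C : Matrix (Fin p) (Fin n) RB) (D : Matrix (Fin p) (Fin d) RB) :
    dataJKc A B C D = fromRows (fromCols (cCol C) (cCol D)) (fromCols (cCol A) (cCol B)) := by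
  ext (i | i) (j | j) <;> rfl

theorem mul_ofComplex_eq_iff (A : Matrix (Fin m) (Fin n) RB) (B : Matrix (Fin m) (Fin d) RB)
    (X : Matrix (Fin n) (Fin d) ℂ) :
    A * ofComplex X = B ↔ fromCols (cCol A) (cCol B) * augment X = 0 := by
  rw [augment, fromCols_mul_fromRows, Matrix.mul_neg, Matrix.mul_one, ← sub_eq_add_neg,
    sub_eq_zero, ← cCol_mul_ofComplex, cCol_injective.eq_iff]

theorem isFeasible_iff (A : Matrix (Fin m) (Fin n) RB) (B : Matrix (Fin m) (Fin d) RB)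
    (C : Matrix (Fin p) (Fin n) RB) (D : Matrix (Fin p) (Fin d) RB) (X : Matrix (Fin n) (Fin d) ℂ)
    (G : Matrix (Fin m) (Fin n) RB) (H : Matrix (Fin m) (Fin d) RB) :
    IsFeasible A B C D X G H ↔ fromCols (cCol C) (cCol D) * augment X = 0 ∧
      (fromCols (cCol A) (cCol B) + fromCols (cCol G) (cCol H)) * augment X = 0 := by
  have h1 : fromCols (cCol A) (cCol B) + fromCols (cCol G) (cCol H) =
      fromCols (cCol (A + G)) (cCol (B + H)) := by
    rw [cCol_add, cCol_add]
    ext i (j | j) <;> rfl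
  rw [IsFeasible, mul_ofComplex_eq_iff, mul_ofComplex_eq_iff, h1, and_comm]

/-- Every complex `E` is the first block column of a pair `[G, H]` with the same norm, so the two
minimizations range over the same corrections. -/
theorem isComplexSolution_iff (A : Matrix (Fin m) (Fin n) RB) (B : Matrix (Fin m) (Fin d) RB)
    (C : Matrix (Fin p) (Fin n) RB) (D : Matrix (Fin p) (Fin d) RB)
    (X : Matrix (Fin n) (Fin d) ℂ) :
    IsComplexSolution A B C D X ↔
      IsTLSSolution (dataJKc A B C D).toRows₁ (dataJKc A B C D).toRows₂ X := by
  have hE : ∀ E : Matrix (Fin m ⊕ Fin m) (Fin n ⊕ Fin d) ℂ,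
      ∃ (G : Matrix (Fin m) (Fin n) RB) (H : Matrix (Fin m) (Fin d) RB),
        fromCols (cCol G) (cCol H) = E := fun E => by
    obtain ⟨G, hG⟩ := exists_cCol_eq E.toCols₁
    obtain ⟨H, hH⟩ := exists_cCol_eq E.toCols₂
    exact ⟨G, H, by rw [hG, hH, fromCols_toCols]⟩
  rw [dataJKc_eq_fromRows, toRows₁_fromRows, toRows₂_fromRows]
  constructor
  · rintro ⟨G, H, hf, hmin⟩
    refine ⟨fromCols (cCol G) (cCol H), (isFeasible_iff ..).1 hf, fun X' E' h1 h2 => ?_⟩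
    obtain ⟨G', H', rfl⟩ := hE E'
    simpa only [rbFrob_fromCols] using hmin X' G' H' ((isFeasible_iff ..).2 ⟨h1, h2⟩)
  · rintro ⟨E, hf, hmin⟩
    obtain ⟨G, H, rfl⟩ := hE E
    refine ⟨G, H, (isFeasible_iff ..).2 hf, fun X' G' H' h' => ?_⟩
    obtain ⟨h1, h2⟩ := (isFeasible_iff ..).1 h'
    simpa only [rbFrob_fromCols] using hmin X' _ h1 h2

end Reduction

/-! ### Spectral data from the given factorizations -/

/-- `S = (Q₁ R)ᴴ` vanishes on `Q₂`, so `Q₂ V` is orthogonal to `Vs`, and the SVD of `P Q₂`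
diagonalizes `P` on its columns. -/
theorem spectralData_of_factorizations {m n d p q : ℕ} (hn : n = 2 * p + q)
    {P : Matrix (Fin m ⊕ Fin m) (Fin n ⊕ Fin d) ℂ}
    {S : Matrix (Fin p ⊕ Fin p) (Fin n ⊕ Fin d) ℂ}
    {Q₁ : Matrix (Fin n ⊕ Fin d) (Fin p ⊕ Fin p) ℂ} {Q₂ : Matrix (Fin n ⊕ Fin d) (Fin q ⊕ Fin d) ℂ}
    {R : Matrix (Fin p ⊕ Fin p) (Fin p ⊕ Fin p) ℂ} (hQR : IsFullQR S Q₁ Q₂ R)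
    {U : Matrix (Fin m ⊕ Fin m) (Fin q ⊕ Fin d) ℂ} {σ₁ : Fin q → ℝ} {σ₂ : Fin d → ℝ}
    {V : Matrix (Fin q ⊕ Fin d) (Fin q ⊕ Fin d) ℂ}
    (hSVD : IsThinSVD (P * Q₂) U (Sum.elim σ₁ σ₂) V) (hgap : ∀ i j, σ₂ j < σ₁ i)
    (hV22 : IsUnit (Q₂ * V).toBlocks₂₂)
    {Us : Matrix (Fin p ⊕ Fin p) (Fin p ⊕ Fin p) ℂ} {s : Fin p ⊕ Fin p → ℝ}
    {Vs : Matrix (Fin n ⊕ Fin d) (Fin p ⊕ Fin p) ℂ} (hSs : IsThinSVD S Us s Vs)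
    {Sd : Matrix (Fin n ⊕ Fin d) (Fin p ⊕ Fin p) ℂ} (hSd : IsMoorePenrose S Sd) :
    SpectralData S P Us s Vs U.toCols₁ σ₁ (Q₂ * V).toCols₁ U.toCols₂ σ₂ (Q₂ * V).toCols₂ Sd := by
  have hQ := hQR.left_unitary
  rw [conjTranspose_fromCols_eq_fromRows_conjTranspose, fromRows_mul_fromCols, ← fromBlocks_one,
    fromBlocks_inj] at hQ
  obtain ⟨-, hQ12, -, hQ22⟩ := hQ
  have hUs : Us * Usᴴ = 1 := mul_eq_one_comm.1 hSs.left_orthonormal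
  have hV' : (Q₂ * V)ᴴ * (Q₂ * V) = 1 := by
    rw [conjTranspose_mul, Matrix.mul_assoc, ← Matrix.mul_assoc Q₂ᴴ, hQ22, Matrix.one_mul,
      hSVD.right_orthonormal]
  have hSQ : S * Q₂ = 0 := by
    have : S = (Q₁ * R)ᴴ := by
      rw [← conjTranspose_conjTranspose S, hQR.factor, fromCols_mul_fromRows, Matrix.mul_zero,
        add_zero]
    rw [this, conjTranspose_mul, Matrix.mul_assoc, hQ12, Matrix.mul_zero]
  have hsi : ∀ {M : Matrix (Fin p ⊕ Fin p) (Fin q ⊕ Fin d) ℂ}, rdiag s * M = 0 → M = 0 := by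
    intro M hM
    ext i j
    have := congrFun (congrFun hM i) j
    rw [rdiag_mul_apply] at this
    exact (mul_eq_zero.1 this).resolve_left (by exact_mod_cast (hSs.pos i).ne')
  have hVsV' : Vsᴴ * (Q₂ * V) = 0 := by
    refine hsi ?_
    have h1 : rdiag s * Vsᴴ = Usᴴ * S := by
      rw [hSs.factor, Matrix.mul_assoc, ← Matrix.mul_assoc Usᴴ, hSs.left_orthonormal,
        Matrix.one_mul]
    rw [← Matrix.mul_assoc, h1, Matrix.mul_assoc, ← Matrix.mul_assoc S, hSQ]
    simp
  have hPV : P * (Q₂ * V) = U * rdiag (Sum.elim σ₁ σ₂) := by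
    rw [← Matrix.mul_assoc, hSVD.factor, Matrix.mul_assoc, hSVD.right_orthonormal, Matrix.mul_one]
  have hUU := hSVD.left_orthonormal
  have hpos := hSVD.pos
  generalize Q₂ * V = V' at *
  have hcols : V' = fromCols V'.toCols₁ V'.toCols₂ := (fromCols_toCols V').symm
  have hUcols : U = fromCols U.toCols₁ U.toCols₂ := (fromCols_toCols U).symm
  have hunit : IsUnit V'.toCols₂.toRows₂.det := (isUnit_iff_isUnit_det _).1 hV22
  generalize V'.toCols₁ = V₁ at *
  generalize V'.toCols₂ = V₂ at *
  generalize U.toCols₁ = U₁ at *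
  generalize U.toCols₂ = U₂ at *
  clear hV22 hSVD
  subst hcols hUcols
  have h1 : (fromCols V₁ V₂)ᴴ * Vs = 0 := by
    rw [← conjTranspose_conjTranspose Vs, ← conjTranspose_mul, hVsV', conjTranspose_zero]
  have hcomplete : fromCols Vs (fromCols V₁ V₂) * (fromCols Vs (fromCols V₁ V₂))ᴴ = 1 := by
    -- The `2p + q + d` orthonormal columns fill a space of dimension `n + d`, so they are complete.
    refine (mul_eq_one_comm_of_card_eq _ _ _
      (by simp only [Fintype.card_sum, Fintype.card_fin]; omega)).1 ?_
    rw [conjTranspose_fromCols_eq_fromRows_conjTranspose, fromRows_mul_fromCols,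
      hSs.right_orthonormal, hVsV', hV',
      h1, fromBlocks_one]
  rw [conjTranspose_fromCols_eq_fromRows_conjTranspose, fromCols_mul_fromRows,
    conjTranspose_fromCols_eq_fromRows_conjTranspose, fromCols_mul_fromRows] at hcomplete
  rw [conjTranspose_fromCols_eq_fromRows_conjTranspose, fromRows_mul_fromCols, ← fromBlocks_one,
    fromBlocks_inj] at hV' hUU
  rw [mul_fromCols, ← fromCols_zero, fromCols_inj.eq_iff] at hVsV'
  have hdiag : rdiag (Sum.elim σ₁ σ₂) = fromBlocks (rdiag σ₁) 0 0 (rdiag σ₂) := by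
    rw [rdiag, rdiag, rdiag, fromBlocks_diagonal]
    congr 1
    funext i
    rcases i with i | i <;> rfl
  rw [hdiag, mul_fromCols, fromCols_mul_fromBlocks, fromCols_inj.eq_iff] at hPV
  have hinv : rdiag s * rdiag (fun i => (s i)⁻¹) = 1 := by
    rw [rdiag, rdiag, diagonal_mul_diagonal, ← diagonal_one]
    congr 1
    funext i
    rw [← Complex.ofReal_mul, mul_inv_cancel₀ (hSs.pos i).ne', Complex.ofReal_one]
  have hSVs : S * Vs = Us * rdiag s := by
    rw [hSs.factor, Matrix.mul_assoc, hSs.right_orthonormal, Matrix.mul_one]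
  have hSsd : S * Sd = 1 := by
    -- `S` has a right inverse `T`, whence `S S† = S S† S T = S T = 1`.
    have h1 : S * (Vs * (rdiag (fun i => (s i)⁻¹) * Usᴴ)) = 1 := by
      rw [← Matrix.mul_assoc, hSVs, Matrix.mul_assoc, ← Matrix.mul_assoc (rdiag s), hinv,
        Matrix.one_mul, hUs]
    rw [← Matrix.mul_one (S * Sd), ← h1, ← Matrix.mul_assoc, hSd.mul_mul_self]
  have hSdS : Sd * (Us * rdiag s) = Vs := by
    -- The columns of `Vs` lie in the range of `Sᴴ`, which the projection `S† S` fixes.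
    have h1 : Vs = Sᴴ * (Us * rdiag (fun i => (s i)⁻¹)) := by
      rw [hSs.factor, conjTranspose_mul, conjTranspose_mul, conjTranspose_conjTranspose,
        rdiag_conjTranspose, Matrix.mul_assoc, Matrix.mul_assoc, ← Matrix.mul_assoc Usᴴ,
        hSs.left_orthonormal, Matrix.one_mul, hinv, Matrix.mul_one]
    have h2 : Sd * S * Sᴴ = Sᴴ := by
      rw [← hSd.right_hermitian, ← conjTranspose_mul, ← Matrix.mul_assoc, hSd.mul_mul_self]
    rw [← hSVs, ← Matrix.mul_assoc, h1, ← Matrix.mul_assoc, h2]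
  exact
    { vs_vs := hSs.right_orthonormal
      vs_v₁ := hVsV'.1
      v₁_v₁ := hV'.1
      vs_v₂ := hVsV'.2
      v₁_v₂ := hV'.2.1
      v₂_v₂ := hV'.2.2.2
      complete := by rw [← hcomplete, add_assoc]
      us_left := hSs.left_orthonormal
      us_right := hUs
      s_pos := hSs.pos
      s_factor := hSs.factor
      p_v₁ := by simpa using hPV.1
      p_v₂ := by simpa using hPV.2
      u₁_u₁ := hUU.1
      u₁_u₂ := hUU.2.1
      u₂_u₂ := hUU.2.2.2
      σ₂_pos := fun j => hpos (.inr j)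
      gap := hgap
      sd_us := hSdS
      s_sd := hSsd
      unit := hunit }

/-! ### Assembling the condition number -/

section ConditionNumber

open scoped Matrix.Norms.Frobenius

theorem hasRelConditionNumber_of_spectralData {m n d p q : ℕ} (hn : n = 2 * p + q)
    {A : Matrix (Fin m) (Fin n) RB} {B : Matrix (Fin m) (Fin d) RB}
    {C : Matrix (Fin p) (Fin n) RB} {D : Matrix (Fin p) (Fin d) RB}
    {Us : Matrix (Fin p ⊕ Fin p) (Fin p ⊕ Fin p) ℂ} {s : Fin p ⊕ Fin p → ℝ}
    {Vs : Matrix (Fin n ⊕ Fin d) (Fin p ⊕ Fin p) ℂ}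
    {U₁ : Matrix (Fin m ⊕ Fin m) (Fin q) ℂ} {σ₁ : Fin q → ℝ}
    {V₁ : Matrix (Fin n ⊕ Fin d) (Fin q) ℂ}
    {U₂ : Matrix (Fin m ⊕ Fin m) (Fin d) ℂ} {σ₂ : Fin d → ℝ}
    {V₂ : Matrix (Fin n ⊕ Fin d) (Fin d) ℂ}
    {Sd : Matrix (Fin n ⊕ Fin d) (Fin p ⊕ Fin p) ℂ}
    (hdata : SpectralData (fromCols (cCol C) (cCol D)) (fromCols (cCol A) (cCol B))
      Us s Vs U₁ σ₁ V₁ U₂ σ₂ V₂ Sd)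
    {X : Matrix (Fin n) (Fin d) ℂ} (hX : IsComplexSolution A B C D X) (hX0 : X ≠ 0) :
    HasRelConditionNumber A B C D X
      (specNorm (Hc hn V₂.toRows₂ (W1c Vs V₁) * Gc (Sc s σ₁) (rdiag σ₂) *
          Zc (fromCols (cCol A) (cCol B) * Sd) Us U₁ U₂) *
        (frobNorm (dataJKc A B C D) / frobNorm X)) := by
  obtain ⟨φ, φ', hφ, hev, hlin⟩ := hdata.exists_solution_map
  rw [← dataJKc_eq_fromRows A B C D] at hφ hev
  have hκ := hdata.specNorm_isLeast hn φ' hlin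
  have hX' : X = φ (dataJKc A B C D) :=
    hev.self_of_nhds.2 X ((isComplexSolution_iff ..).1 hX)
  obtain ⟨δ, hδ, hball⟩ := Metric.eventually_nhds_iff.1 hev
  have hsol : ∀ (ΔA : Matrix (Fin m) (Fin n) RB) (ΔB : Matrix (Fin m) (Fin d) RB)
      (ΔC : Matrix (Fin p) (Fin n) RB) (ΔD : Matrix (Fin p) (Fin d) RB) X',
      rbFrob (dataJK ΔA ΔB ΔC ΔD) < δ →
        (IsComplexSolution (A + ΔA) (B + ΔB) (C + ΔC) (D + ΔD) X' ↔
          X' = φ (dataJKc A B C D + dataJKc ΔA ΔB ΔC ΔD)) := by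
    intro ΔA ΔB ΔC ΔD X' hlt
    rw [rbFrob_dataJK] at hlt
    obtain ⟨h1, h2⟩ := hball (y := dataJKc A B C D + dataJKc ΔA ΔB ΔC ΔD) (by
      rw [dist_eq_norm, add_sub_cancel_left]; exact hlt)
    rw [isComplexSolution_iff, dataJKc_add]
    exact ⟨h2 X', fun h => h ▸ h1⟩
  -- Half the radius is used because the neighbourhood is an open ball, while the definition admits
  -- equality.
  refine ⟨⟨δ / 2, half_pos hδ, fun ΔA ΔB ΔC ΔD hle => ?_⟩, ?_⟩
  · have hlt := hle.trans_lt (half_lt_self hδ)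
    exact ⟨_, (hsol ΔA ΔB ΔC ΔD _ hlt).2 rfl, fun X' h => (hsol ΔA ΔB ΔC ΔD X' hlt).1 h⟩
  · have hc : 0 < frobNorm X := norm_pos_iff.2 hX0
    have hlim := tendsto_sSup_relChange hφ hκ (norm_nonneg (dataJKc A B C D)) hc
    refine hlim.congr' ?_
    have hε : ∀ᶠ ε : ℝ in 𝓝[>] 0, ε * rbFrob (dataJK A B C D) < δ := by
      have : Continuous fun ε : ℝ => ε * rbFrob (dataJK A B C D) := by fun_prop
      exact ((this.tendsto 0).mono_left nhdsWithin_le_nhds).eventually_lt_const (by simpa using hδ)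
    filter_upwards [hε] with ε hεδ
    rw [relChangeSup]
    -- For such `ε` every admissible perturbed solution is a value of `φ`, so the two sets of
    -- relative changes coincide.
    congr 1
    ext r
    constructor
    · rintro ⟨Δ, hΔ, rfl⟩
      obtain ⟨ΔA, ΔB, ΔC, ΔD, rfl⟩ := exists_dataJKc_eq Δ
      rw [← rbFrob_dataJK, ← rbFrob_dataJK] at hΔ
      exact ⟨ΔA, ΔB, ΔC, ΔD, _, hΔ, (hsol ΔA ΔB ΔC ΔD _ (hΔ.trans_lt hεδ)).2 rfl, by
        rw [← hX']; rfl⟩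
    · rintro ⟨ΔA, ΔB, ΔC, ΔD, X', hΔ, hX'', rfl⟩
      obtain rfl := (hsol ΔA ΔB ΔC ΔD _ (hΔ.trans_lt hεδ)).1 hX''
      rw [rbFrob_dataJK, rbFrob_dataJK] at hΔ
      exact ⟨dataJKc ΔA ΔB ΔC ΔD, hΔ, by rw [← hX']; rfl⟩

end ConditionNumber

end RBTLSE

end

open RBTLSE
theorem theorem5p2 {m n d p q : ℕ} (hn : n = 2 * p + q) (hm : n + d ≤ m)
    -- the data of the problem
    (A : Matrix (Fin m) (Fin n) RB) (B : Matrix (Fin m) (Fin d) RB)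
    (C : Matrix (Fin p) (Fin n) RB) (D : Matrix (Fin p) (Fin d) RB)
    (hC : (cCol C).rank = 2 * p)
    (P : Matrix (Fin m ⊕ Fin m) (Fin n ⊕ Fin d) ℂ)
    (S : Matrix (Fin p ⊕ Fin p) (Fin n ⊕ Fin d) ℂ)
    (hP : P = fromCols (cCol A) (cCol B)) (hS : S = fromCols (cCol C) (cCol D))
    -- QR factorization of Sᴴ
    (Q₁ : Matrix (Fin n ⊕ Fin d) (Fin p ⊕ Fin p) ℂ) (Q₂ : Matrix (Fin n ⊕ Fin d) (Fin q ⊕ Fin d) ℂ)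
    (R : Matrix (Fin p ⊕ Fin p) (Fin p ⊕ Fin p) ℂ) (hQR : IsFullQR S Q₁ Q₂ R)
    -- thin singular value decomposition of P Q₂, with singular values (σ₁, σ₂)
    (U : Matrix (Fin m ⊕ Fin m) (Fin q ⊕ Fin d) ℂ) (σ₁ : Fin q → ℝ) (σ₂ : Fin d → ℝ)
    (V : Matrix (Fin q ⊕ Fin d) (Fin q ⊕ Fin d) ℂ)
    (hSVD : IsThinSVD (P * Q₂) U (Sum.elim σ₁ σ₂) V)
    (hσ₁ : Antitone σ₁) (hσ₂ : Antitone σ₂) (hgap : ∀ i j, σ₂ j < σ₁ i)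
    (V' : Matrix (Fin n ⊕ Fin d) (Fin q ⊕ Fin d) ℂ) (hV' : V' = Q₂ * V)
    (hV22 : IsUnit V'.toBlocks₂₂)
    -- skinny singular value decomposition and Moore-Penrose inverse of S
    (Us : Matrix (Fin p ⊕ Fin p) (Fin p ⊕ Fin p) ℂ) (s : Fin p ⊕ Fin p → ℝ)
    (Vs : Matrix (Fin n ⊕ Fin d) (Fin p ⊕ Fin p) ℂ)
    (hSs : IsThinSVD S Us s Vs) (hs : Antitone (s ∘ finSumFinEquiv.symm))
    (Sd : Matrix (Fin n ⊕ Fin d) (Fin p ⊕ Fin p) ℂ) (hSd : IsMoorePenrose S Sd)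
    -- the complex solution
    (X : Matrix (Fin n) (Fin d) ℂ) (hX : IsComplexSolution A B C D X) (hX0 : X ≠ 0) :
    HasRelConditionNumber A B C D X
      (specNorm (Hc hn V'.toBlocks₂₂ (W1c Vs V'.toCols₁) * Gc (Sc s σ₁) (rdiag σ₂) *
          Zc (P * Sd) Us U.toCols₁ U.toCols₂) *
        (frobNorm (dataJKc A B C D) / frobNorm X)) := by
  subst hP hS hV'
  exact hasRelConditionNumber_of_spectralData hn
    (spectralData_of_factorizations hn hQR hSVD hgap hV22 hSs hSd) hX hX0
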